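/- Let $(X,g)$ be a smooth Riemannian $7$-manifold with Levi-Civita connection $\nabla$ and let $\varphi$ be a smooth $3$-form on $X$ such that at every point there is a $g$-orthonormal basis of the tangent space, with dual basis $\varepsilon^1,\dots,\varepsilon^7$, in which $$\varphi=\varepsilon^{123}+\varepsilon^1\wedge(\varepsilon^{45}-\varepsilon^{67})+\varepsilon^2\wedge(\varepsilon^{46}-\varepsilon^{75})+\varepsilon^3\wedge(\varepsilon^{47}-\varepsilon^{56}).$$ Suppose that $\nabla\varphi=0$, i.e. that $X$ is a $G_2$-manifold. Let $\times$ be the vector cross product on the tangent spaces, $\langle y\times z,w\rangle=\varphi(y,z,w)$. Let $\Sigma$ be an oriented smooth surface and $f:\Sigma\to X$ a smooth immersion (for instance the inclusion of a $2$-dimensional submanifold). For $p\in\Sigma$ let $\eta(p)=y\times z$, where $y,z$ is any oriented orthonormal basis of $f_*(T_p\Sigma)$; this is a unit normal vector. Let $W$ be the subbundle of the normal bundle of $\Sigma$ consisting of the normal vectors orthogonal to $\eta$; it has real rank $4$ and is a complex vector bundle of rank $2$ with the complex structure $\mathcal{J}v=\eta\times v$. Let $\nabla^W$ be the connection on $W$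 induced from $\nabla$, that is, $\nabla^W_u s$ is the orthogonal projection to $W$ of $(f^*\nabla)_u s$, and let $B(v,w)=(\nabla_v w)^N$ be the second fundamental form of $\Sigma$, with values in the normal bundle. Then $\nabla^W$ is Hermitian with respect to $\mathcal{J}$ (i.e. it is compatible with the metric induced on $W$, and $\mathcal{J}$ is parallel, $\nabla^W\mathcal{J}=0$) if and only if $B$ takes values in $W$. -/

import Mathlib

open Bundle Module
open scoped Manifold ContDiff Topology InnerProductSpace

noncomputable section

namespace G2Surface

/-- Model space of a `7`-manifold. -/
abbrev R7 : Type := EuclideanSpace ℝ (Fin 7)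

/-- Model space of a surface. -/
abbrev R2 : Type := EuclideanSpace ℝ (Fin 2)

/-! ### The model three-form -/

/-- The value of `ε^i ∧ ε^j ∧ ε^k` on `(u, v, w)`. -/
def wedge3 (i j k : Fin 7) (u v w : R7) : ℝ :=
  Matrix.det !![u i, u j, u k; v i, v j, v k; w i, w j, w k]

/-- `φ₀ = ε¹²³ + ε¹ ∧ (ε⁴⁵ - ε⁶⁷) + ε² ∧ (ε⁴⁶ - ε⁷⁵) + ε³ ∧ (ε⁴⁷ - ε⁵⁶)`
(the indices are shifted by one, since `Fin 7` starts at `0`). -/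
def phi0 (u v w : R7) : ℝ :=
  wedge3 0 1 2 u v w
    + (wedge3 0 3 4 u v w - wedge3 0 5 6 u v w)
    + (wedge3 1 3 5 u v w - wedge3 1 6 4 u v w)
    + (wedge3 2 3 6 u v w - wedge3 2 4 5 u v w)

/-- `⟪v, a × (a × b)⟫ = ⟪a, b⟫ ⟪a, v⟫ - |a|² ⟪v, b⟫` for the model cross product, where `c` stands
for `a × b`. -/
theorem phi0_cross_cross (a b c v : R7) (hc : ∀ w, ⟪c, w⟫_ℝ = phi0 a b w) :
    phi0 a c v = ⟪a, b⟫_ℝ * ⟪a, v⟫_ℝ - ⟪a, a⟫_ℝ * ⟪b, v⟫_ℝ := by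
  have h (i : Fin 7) : c i = phi0 a b (EuclideanSpace.single i 1) := by
    rw [← hc, EuclideanSpace.inner_single_right]; simp
  have hi (x y : R7) : ⟪x, y⟫_ℝ = x 0 * y 0 + x 1 * y 1 + x 2 * y 2 + x 3 * y 3 + x 4 * y 4 +
      x 5 * y 5 + x 6 * y 6 := by
    rw [PiLp.inner_apply]
    simp [Fin.sum_univ_seven, mul_comm]
  have h0 := h 0
  have h1 := h 1
  have h2 := h 2
  have h3 := h 3
  have h4 := h 4
  have h5 := h 5
  have h6 := h 6
  simp [phi0, wedge3, Matrix.det_fin_three] at h0 h1 h2 h3 h4 h5 h6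
  rw [hi, hi, hi, hi]
  simp [phi0, wedge3, Matrix.det_fin_three, h0, h1, h2, h3, h4, h5, h6]
  ring

theorem phi0_swap (a b c : R7) : phi0 a b c = - phi0 a c b := by
  simp [phi0, wedge3, Matrix.det_fin_three]; ring

theorem phi0_cycle (a b c : R7) : phi0 a b c = phi0 b c a := by
  simp [phi0, wedge3, Matrix.det_fin_three]; ring

/-! ### `G₂`-structures on Riemannian `7`-manifolds -/

section Ambient

variable {X : Type*} [TopologicalSpace X] [ChartedSpace R7 X] [IsManifold (𝓡 7) ∞ X]
  [RiemannianBundle (fun x : X ↦ TangentSpace (𝓡 7) x)]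

instance instFiniteDimensional (x : X) : FiniteDimensional ℝ (TangentSpace (𝓡 7) x) :=
  inferInstanceAs (FiniteDimensional ℝ R7)

instance instCompleteSpace (x : X) : CompleteSpace (TangentSpace (𝓡 7) x) :=
  FiniteDimensional.complete ℝ _

variable (X) in
/-- A `G₂`-structure on a Riemannian `7`-manifold: a smooth three-form that at each point takes the
form `φ₀` in some basis which is orthonormal for the given metric, so that this metric is the
one which the three-form determines. -/
structure G2Structure where
  form : ∀ x : X, TangentSpace (𝓡 7) x →ₗ[ℝ] TangentSpace (𝓡 7) x →ₗ[ℝ]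
    TangentSpace (𝓡 7) x →ₗ[ℝ] ℝ
  /-- The function `φ(U, V, W)` is smooth near `x` for vector fields smooth near `x`. -/
  smooth : ∀ (x : X) (U V W : ∀ y : X, TangentSpace (𝓡 7) y),
    ContMDiffAt (𝓡 7) (𝓡 7).tangent ∞ (fun y ↦ (⟨y, U y⟩ : TangentBundle (𝓡 7) X)) x →
    ContMDiffAt (𝓡 7) (𝓡 7).tangent ∞ (fun y ↦ (⟨y, V y⟩ : TangentBundle (𝓡 7) X)) x →
    ContMDiffAt (𝓡 7) (𝓡 7).tangent ∞ (fun y ↦ (⟨y, W y⟩ : TangentBundle (𝓡 7) X)) x →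
      ContMDiffAt (𝓡 7) 𝓘(ℝ, ℝ) ∞ (fun y ↦ form y (U y) (V y) (W y)) x
  exists_frame : ∀ x : X, ∃ b : OrthonormalBasis (Fin 7) ℝ (TangentSpace (𝓡 7) x),
    ∀ u v w, form x u v w = phi0 (b.repr u) (b.repr v) (b.repr w)

namespace G2Structure

variable (G : G2Structure X)

/-- The vector cross product, `⟪y × z, w⟫ = φ(y, z, w)`. -/
def cross (x : X) (y : TangentSpace (𝓡 7) x) :
    TangentSpace (𝓡 7) x →ₗ[ℝ] TangentSpace (𝓡 7) x where
  toFun z := (InnerProductSpace.toDual ℝ (TangentSpace (𝓡 7) x)).symm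
    (LinearMap.toContinuousLinearMap (G.form x y z))
  map_add' := by intros; simp
  map_smul' := by intros; simp

theorem inner_cross (x : X) (y z w : TangentSpace (𝓡 7) x) :
    ⟪G.cross x y z, w⟫_ℝ = G.form x y z w := by
  simp [cross]

theorem form_swap (x : X) (a b c : TangentSpace (𝓡 7) x) :
    G.form x a b c = - G.form x a c b := by
  obtain ⟨e, he⟩ := G.exists_frame x
  rw [he, he, phi0_swap]

theorem form_cycle (x : X) (a b c : TangentSpace (𝓡 7) x) :
    G.form x a b c = G.form x b c a := by
  obtain ⟨e, he⟩ := G.exists_frame x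
  rw [he, he, phi0_cycle]

theorem form_self (x : X) (a b : TangentSpace (𝓡 7) x) : G.form x a b a = 0 := by
  have h := G.form_swap x b a a
  rw [G.form_cycle]
  linarith

theorem cross_swap (x : X) (a b : TangentSpace (𝓡 7) x) :
    G.cross x a b = - G.cross x b a := by
  refine ext_inner_right ℝ fun w ↦ ?_
  rw [inner_neg_left, inner_cross, inner_cross, G.form_swap x a b w, G.form_cycle x b a w]

theorem cross_combination (x : X) (y z : TangentSpace (𝓡 7) x) (α β γ δ : ℝ) :
    G.cross x (α • y + β • z) (γ • y + δ • z) = (α * δ - β * γ) • G.cross x y z := by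
  refine ext_inner_right ℝ fun w ↦ ?_
  have hyy : G.form x y y w = 0 := by rw [G.form_cycle, G.form_self]
  have hzz : G.form x z z w = 0 := by rw [G.form_cycle, G.form_self]
  have hzy : G.form x z y w = - G.form x y z w := by
    rw [G.form_cycle x z y w, G.form_swap x y w z]
  rw [inner_smul_left, inner_cross, inner_cross]
  simp only [map_add, map_smul, LinearMap.add_apply, LinearMap.smul_apply,
    smul_eq_mul, hyy, hzz, hzy, conj_trivial]
  ring

theorem form_cross (x : X) (a b v : TangentSpace (𝓡 7) x) :
    G.form x a (G.cross x a b) v = ⟪a, b⟫_ℝ * ⟪a, v⟫_ℝ - ⟪a, a⟫_ℝ * ⟪b, v⟫_ℝ := by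
  obtain ⟨e, he⟩ := G.exists_frame x
  rw [he, phi0_cross_cross (e.repr a) (e.repr b)]
  · simp
  · intro w
    have := G.inner_cross x a b (e.repr.symm w)
    rw [he] at this
    rw [← e.repr.inner_map_map] at this
    simpa using this

/-- `∇φ = 0`, that is,
`u(φ(A, B, C)) = φ(∇_u A, B, C) + φ(A, ∇_u B, C) + φ(A, B, ∇_u C)`. -/
def IsParallel (nabla : CovariantDerivative (𝓡 7) R7 (fun x : X ↦ TangentSpace (𝓡 7) x)) : Prop :=
  ∀ (x : X) (A B C : ∀ y : X, TangentSpace (𝓡 7) y),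
    MDifferentiableAt (𝓡 7) (𝓡 7).tangent (fun y ↦ (⟨y, A y⟩ : TangentBundle (𝓡 7) X)) x →
    MDifferentiableAt (𝓡 7) (𝓡 7).tangent (fun y ↦ (⟨y, B y⟩ : TangentBundle (𝓡 7) X)) x →
    MDifferentiableAt (𝓡 7) (𝓡 7).tangent (fun y ↦ (⟨y, C y⟩ : TangentBundle (𝓡 7) X)) x →
      ∀ u : TangentSpace (𝓡 7) x,
        mvfderiv (𝓡 7) (fun y ↦ G.form y (A y) (B y) (C y)) x u =
          G.form x (nabla A x u) (B x) (C x) + G.form x (A x) (nabla B x u) (C x) +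
            G.form x (A x) (B x) (nabla C x u)

end G2Structure

variable [IsContMDiffRiemannianBundle (𝓡 7) ∞ R7 (fun x : X ↦ TangentSpace (𝓡 7) x)]

/-- The Levi-Civita connection: metric and torsion-free. -/
def IsLeviCivita (nabla : CovariantDerivative (𝓡 7) R7 (fun x : X ↦ TangentSpace (𝓡 7) x)) :
    Prop :=
  haveI : IsContMDiffRiemannianBundle (𝓡 7) 1 R7 (fun x : X ↦ TangentSpace (𝓡 7) x) :=
    IsContMDiffRiemannianBundle.of_le (n := ∞) (by simp)
  nabla.IsMetricCompatible ∧ nabla.torsion = 0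

end Ambient

/-! ### Oriented surfaces -/

/-- An orientation of a surface: an orientation of each tangent plane which, in the standard local
trivializations of the tangent bundle, is locally constant. -/
structure SurfaceOrientation (S : Type*) [TopologicalSpace S] [ChartedSpace R2 S]
    [IsManifold (𝓡 2) ∞ S] where
  at_point : ∀ p : S, Orientation ℝ (TangentSpace (𝓡 2) p) (Fin 2)
  locally_constant : ∀ p : S, ∃ o : Orientation ℝ R2 (Fin 2), ∀ᶠ q in 𝓝 p,
    ∀ hq : q ∈ (trivializationAt R2 (fun q : S ↦ TangentSpace (𝓡 2) q) p).baseSet,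
      Orientation.map (Fin 2) ((trivializationAt R2 (fun q : S ↦ TangentSpace (𝓡 2) q)
        p).continuousLinearEquivAt ℝ q hq).toLinearEquiv (at_point q) = o

/-! ### Immersed surfaces -/

section Immersed

variable {X : Type*} [TopologicalSpace X] [ChartedSpace R7 X] [IsManifold (𝓡 7) ∞ X]
  [RiemannianBundle (fun x : X ↦ TangentSpace (𝓡 7) x)]
  {S : Type*} [TopologicalSpace S] [ChartedSpace R2 S] [IsManifold (𝓡 2) ∞ S]

instance instFiniteDimensionalSurface (p : S) : FiniteDimensional ℝ (TangentSpace (𝓡 2) p) :=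
  inferInstanceAs (FiniteDimensional ℝ R2)

theorem finrank_tangentSpace {S : Type*} [TopologicalSpace S] [ChartedSpace R2 S] (p : S) : finrank ℝ (TangentSpace (𝓡 2) p) = 2 := by
  change finrank ℝ R2 = 2
  simp

/-- The pull-back `f^*∇` of a connection to a connection on `f^*TX`, acting on vector fields `V`
along `f`. In the local trivialization of `TX` around `f p`, write `V = ∑ Vⁱ Eᵢ ∘ f` where `(Eᵢ)` is
the coordinate frame; then `(f^*∇)_u V = ∑ (dVⁱ(u) Eᵢ + Vⁱ(p) ∇_{df(u)} Eᵢ)` at `p`. -/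
def covAlong (nabla : CovariantDerivative (𝓡 7) R7 (fun x : X ↦ TangentSpace (𝓡 7) x)) (f : S → X)
    (V : ∀ q : S, TangentSpace (𝓡 7) (f q)) (p : S) :
    TangentSpace (𝓡 2) p →L[ℝ] TangentSpace (𝓡 7) (f p) :=
  letI e := trivializationAt R7 (fun x : X ↦ TangentSpace (𝓡 7) x) (f p)
  letI coord : S → R7 := fun q ↦ (e ⟨f q, V q⟩).2
  (e.symmL ℝ (f p)).comp (mvfderiv (𝓡 2) coord p) +
    (nabla (fun x ↦ e.symm x (coord p)) (f p)).comp (mfderiv (𝓡 2) (𝓡 7) f p)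

/-- The image `df(T_pΣ)` of the tangent plane. -/
def tangentPlane (f : S → X) (p : S) : Submodule ℝ (TangentSpace (𝓡 7) (f p)) :=
  LinearMap.range (mfderiv (𝓡 2) (𝓡 7) f p).toLinearMap

/-- The normal space, the orthogonal complement of the tangent plane. -/
def normalSpace (f : S → X) (p : S) : Submodule ℝ (TangentSpace (𝓡 7) (f p)) :=
  (tangentPlane f p)ᗮ

variable (G : G2Structure X) (o : SurfaceOrientation S) (f : S → X)

/-- A positively oriented basis of the tangent plane at `p`. -/
def orientedBasis (p : S) : Basis (Fin 2) ℝ (TangentSpace (𝓡 2) p) :=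
  (o.at_point p).someBasis (by simp [finrank_tangentSpace])

/-- The cross product `df(b₁) × df(b₂)` for the chosen positively oriented basis. -/
def etaAux (p : S) : TangentSpace (𝓡 7) (f p) :=
  G.cross (f p) (mfderiv (𝓡 2) (𝓡 7) f p (orientedBasis o p 0))
    (mfderiv (𝓡 2) (𝓡 7) f p (orientedBasis o p 1))

/-- The distinguished unit normal `η = y × z`, where `y, z` is an oriented orthonormal basis of
the tangent plane. For an arbitrary oriented basis the cross product is a positive multiple of `η`,
so it is normalized here. -/
def eta (p : S) : TangentSpace (𝓡 7) (f p) :=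
  ‖etaAux G o f p‖⁻¹ • etaAux G o f p

theorem eta_eq (p : S) (b : Basis (Fin 2) ℝ (TangentSpace (𝓡 2) p))
    (hb : b.orientation = o.at_point p)
    (hon : Orthonormal ℝ fun i ↦ (mfderiv (𝓡 2) (𝓡 7) f p (b i) : TangentSpace (𝓡 7) (f p))) :
    eta G o f p = G.cross (f p) (mfderiv (𝓡 2) (𝓡 7) f p (b 0)) (mfderiv (𝓡 2) (𝓡 7) f p (b 1)) := by
  set b' := orientedBasis o p with hb'
  have hdet : 0 < b.det b' := by
    rw [← Basis.orientation_eq_iff_det_pos, hb, hb', orientedBasis, Orientation.someBasis_orientation]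
  rw [Basis.det_apply, Matrix.det_fin_two] at hdet
  simp only [Basis.toMatrix_apply] at hdet
  have hexp (j : Fin 2) : mfderiv (𝓡 2) (𝓡 7) f p (b' j) =
      b.repr (b' j) 0 • mfderiv (𝓡 2) (𝓡 7) f p (b 0) +
        b.repr (b' j) 1 • mfderiv (𝓡 2) (𝓡 7) f p (b 1) := by
    conv_lhs => rw [← b.sum_repr (b' j), Fin.sum_univ_two, map_add, map_smul, map_smul]
  have haux : etaAux G o f p = (b.repr (b' 0) 0 * b.repr (b' 1) 1 - b.repr (b' 0) 1 *
      b.repr (b' 1) 0) • G.cross (f p) (mfderiv (𝓡 2) (𝓡 7) f p (b 0))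
        (mfderiv (𝓡 2) (𝓡 7) f p (b 1)) := by
    rw [etaAux, ← hb', hexp 0, hexp 1, G.cross_combination]
  have hnorm : ‖G.cross (f p) (mfderiv (𝓡 2) (𝓡 7) f p (b 0))
      (mfderiv (𝓡 2) (𝓡 7) f p (b 1))‖ = 1 := by
    have h00 := hon.1 0
    have h11 := hon.1 1
    have h01 := hon.2 (show (0 : Fin 2) ≠ 1 by decide)
    have h := G.inner_cross (f p) (mfderiv (𝓡 2) (𝓡 7) f p (b 0)) (mfderiv (𝓡 2) (𝓡 7) f p (b 1))
      (G.cross (f p) (mfderiv (𝓡 2) (𝓡 7) f p (b 0)) (mfderiv (𝓡 2) (𝓡 7) f p (b 1)))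
    rw [G.form_swap, G.form_cross, real_inner_self_eq_norm_sq, real_inner_self_eq_norm_sq,
      real_inner_self_eq_norm_sq, h00, h11, h01] at h
    have h0 := norm_nonneg (G.cross (f p) (mfderiv (𝓡 2) (𝓡 7) f p (b 0))
      (mfderiv (𝓡 2) (𝓡 7) f p (b 1)))
    nlinarith
  have hpos : 0 < b.repr (b' 0) 0 * b.repr (b' 1) 1 - b.repr (b' 0) 1 * b.repr (b' 1) 0 := by
    linarith
  rw [eta, haux, norm_smul, hnorm, Real.norm_of_nonneg hpos.le, smul_smul, mul_one,
    inv_mul_cancel₀ hpos.ne', one_smul]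

/-- The bundle `W`: the normal vectors orthogonal to `η`. -/
def bundleW (p : S) : Submodule ℝ (TangentSpace (𝓡 7) (f p)) :=
  normalSpace f p ⊓ (ℝ ∙ eta G o f p)ᗮ

theorem mem_bundleW {p : S} {v : TangentSpace (𝓡 7) (f p)} : v ∈ bundleW G o f p ↔
    (∀ t : TangentSpace (𝓡 2) p, ⟪(mfderiv (𝓡 2) (𝓡 7) f p t : TangentSpace (𝓡 7) (f p)), v⟫_ℝ = 0)
      ∧ ⟪eta G o f p, v⟫_ℝ = 0 := by
  rw [bundleW, Submodule.mem_inf, Submodule.mem_orthogonal_singleton_iff_inner_right, normalSpace,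
    Submodule.mem_orthogonal]
  refine and_congr_left fun _ ↦ ⟨fun h t ↦ h _ ⟨t, rfl⟩, ?_⟩
  rintro h _ ⟨t, rfl⟩
  exact h t

theorem cross_eta_mem (p : S) (v : TangentSpace (𝓡 7) (f p)) (hv : v ∈ bundleW G o f p) :
    G.cross (f p) (eta G o f p) v ∈ bundleW G o f p := by
  rw [mem_bundleW] at hv ⊢
  obtain ⟨hT, hE⟩ := hv
  have key (i : Fin 2) : ⟪(mfderiv (𝓡 2) (𝓡 7) f p (orientedBasis o p i) :
      TangentSpace (𝓡 7) (f p)), G.cross (f p) (eta G o f p) v⟫_ℝ = 0 := by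
    rw [real_inner_comm, G.inner_cross, ← G.form_cycle]
    fin_cases i
    · simp [eta, etaAux, G.form_cross, hT]
    · rw [eta, etaAux, G.cross_swap]
      simp [G.form_cross, hT]
  refine ⟨fun t ↦ ?_, ?_⟩
  · rw [← (orientedBasis o p).sum_repr t, Fin.sum_univ_two, map_add, map_smul, map_smul,
      inner_add_left, inner_smul_left, inner_smul_left, key, key]
    simp
  · rw [real_inner_comm, G.inner_cross, G.form_self]

/-- The complex structure of `W`: cross product with `η`. -/
def complexStructure (p : S) : bundleW G o f p →ₗ[ℝ] bundleW G o f p :=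
  (G.cross (f p) (eta G o f p)).restrict (cross_eta_mem G o f p)

variable (nabla : CovariantDerivative (𝓡 7) R7 (fun x : X ↦ TangentSpace (𝓡 7) x))

/-- The connection `∇^W` induced on `W`: the orthogonal projection to `W` of the pull-back
connection. -/
def connectionW (s : ∀ q : S, bundleW G o f q) (p : S) :
    TangentSpace (𝓡 2) p →L[ℝ] bundleW G o f p :=
  (bundleW G o f p).orthogonalProjectionOnto.comp
    (covAlong nabla f (fun q ↦ (s q : TangentSpace (𝓡 7) (f q))) p)

/-- The section `s` of `W` is differentiable at `p`, as a map into the tangent bundle of `X`. -/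
def DifferentiableSectionAt (s : ∀ q : S, bundleW G o f q) (p : S) : Prop :=
  MDifferentiableAt (𝓡 2) (𝓡 7).tangent (fun q ↦ (⟨f q, s q⟩ : TangentBundle (𝓡 7) X)) p

/-- The connection `∇^W` is Hermitian: it is compatible with the metric of `W`, and the complex
structure `J` of `W` is parallel. -/
structure ConnectionWIsHermitian : Prop where
  metric : ∀ (p : S) (s t : ∀ q : S, bundleW G o f q),
    DifferentiableSectionAt G o f s p → DifferentiableSectionAt G o f t p →
      ∀ u : TangentSpace (𝓡 2) p,
        mvfderiv (𝓡 2) (fun q ↦ ⟪s q, t q⟫_ℝ) p u =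
          ⟪connectionW G o f nabla s p u, t p⟫_ℝ + ⟪s p, connectionW G o f nabla t p u⟫_ℝ
  parallel : ∀ (p : S) (s : ∀ q : S, bundleW G o f q), DifferentiableSectionAt G o f s p →
    ∀ u : TangentSpace (𝓡 2) p,
      connectionW G o f nabla (fun q ↦ complexStructure G o f q (s q)) p u =
        complexStructure G o f p (connectionW G o f nabla s p u)

/-- The second fundamental form `B(u, Y) = (∇_u (df Y))^N` at `p`, for `u` tangent to the surface
at `p` and a vector field `Y` on the surface. -/
def secondFundamentalForm (p : S) (u : TangentSpace (𝓡 2) p)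
    (Y : ∀ q : S, TangentSpace (𝓡 2) q) : TangentSpace (𝓡 7) (f p) :=
  (normalSpace f p).starProjection
    (covAlong nabla f (fun q ↦ mfderiv (𝓡 2) (𝓡 7) f q (Y q)) p u)

/-- The second fundamental form takes values in `W`. -/
def SecondFundamentalFormInW : Prop :=
  ∀ (p : S) (u : TangentSpace (𝓡 2) p) (Y : ∀ q : S, TangentSpace (𝓡 2) q),
    ContMDiffAt (𝓡 2) (𝓡 2).tangent ∞ (fun q ↦ (⟨q, Y q⟩ : TangentBundle (𝓡 2) S)) p →
      secondFundamentalForm f nabla p u Y ∈ bundleW G o f p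

end Immersed

end G2Surface

end

open G2Surface

/-! Everything reduces to the tangential part of the derivative of `η`. Projecting a metric
connection orthogonally to `W` keeps it metric, so only the parallelism of `J` is at stake. Since
`φ` and the metric are parallel, so is the cross product, and for sections `s` and vectors `w` of
`W` the Leibniz rule gives `⟪(∇^W_u J) s, w⟫ = φ(∇_u η, s, w)`
(`inner_connectionW_complexStructure`).

Because `η` has length one, `∇_u η` is orthogonal to `η`, hence it is the sum of a tangent vector
`τ` and a vector of `W`. The tangent plane together with `η` is an associative three-plane, and `φ`
vanishes on its orthogonal complement `W` (`G2Structure.form_eq_zero`), so the `W`-part contributes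
nothing. Cross product with `τ` maps `W` to itself (`cross_mfderiv_mem`) and multiplies lengths by
`|τ|`; as `W` is not zero, `∇^W_u J` vanishes exactly when `τ = 0` (`connectionWIsHermitian_iff`).
Differentiating `⟪df Y, η⟫ = 0` gives `⟪B(u, Y), η⟫ = -⟪df Y, ∇_u η⟫`, so `τ = 0` for all `u` says
precisely that `B` has no `η`-component (`secondFundamentalForm_mem_bundleW_iff`).

The analytic work lies in the product rules for the pull-back connection (`mvfderiv_form`,
`mvfderiv_inner`), which are reduced to coordinate fields, in the differentiability of `η`
(`exists_eta_eq`), and in finding enough differentiable sections of `W` (`exists_section_bundleW`).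
-/

set_option linter.unusedSectionVars false

namespace G2Surface

/-- The expansion of a vector in the Gram-Schmidt orthogonalization of a basis. -/
theorem eq_sum_gramSchmidt {E : Type*} [NormedAddCommGroup E] [InnerProductSpace ℝ E]
    [FiniteDimensional ℝ E] {n : ℕ} {e : Fin n → E} (he : LinearIndependent ℝ e) (hc : finrank ℝ E = n) (v : E) :
    v = ∑ i, (⟪v, InnerProductSpace.gramSchmidt ℝ e i⟫_ℝ *
      (⟪InnerProductSpace.gramSchmidt ℝ e i, InnerProductSpace.gramSchmidt ℝ e i⟫_ℝ)⁻¹) •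
        InnerProductSpace.gramSchmidt ℝ e i := by
  have hspan : Submodule.span ℝ (Set.range (InnerProductSpace.gramSchmidt ℝ e)) = ⊤ := by
    rw [InnerProductSpace.span_gramSchmidt]
    exact he.span_eq_top_of_card_eq_finrank' (by simp [hc])
  let b := Basis.mk (InnerProductSpace.gramSchmidt_linearIndependent he) hspan.ge
  have hb (i) : b i = InnerProductSpace.gramSchmidt ℝ e i := by simp [b]
  refine InnerProductSpace.ext_inner_right_basis (𝕜 := ℝ) b fun j ↦ ?_
  rw [hb, sum_inner, Finset.sum_eq_single j]
  · rw [inner_smul_left, conj_trivial, inv_mul_cancel_right₀]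
    rw [real_inner_self_eq_norm_sq]
    exact pow_ne_zero _ (norm_ne_zero_iff.2 (InnerProductSpace.gramSchmidt_ne_zero j he))
  · intro i _ hij
    rw [inner_smul_left, InnerProductSpace.gramSchmidt_orthogonal ℝ _ hij, mul_zero]
  · simp

/-! ### Differentiable vector fields along a map -/

section Along

variable {X : Type*} [TopologicalSpace X] [ChartedSpace R7 X]
  {S : Type*} [TopologicalSpace S] [ChartedSpace R2 S]

theorem mdifferentiableAt_finset_sum {ι : Type*} (t : Finset ι) {g : ι → S → ℝ} {p : S}
    (hg : ∀ i ∈ t, MDifferentiableAt (𝓡 2) 𝓘(ℝ, ℝ) (g i) p) :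
    MDifferentiableAt (𝓡 2) 𝓘(ℝ, ℝ) (fun q ↦ ∑ i ∈ t, g i q) p := by
  classical
  induction t using Finset.induction_on with
  | empty => simpa using mdifferentiableAt_const
  | insert a t ha ih =>
    simp only [Finset.sum_insert ha]
    exact (hg a (Finset.mem_insert_self a t)).add
      (ih fun i hi ↦ hg i (Finset.mem_insert_of_mem hi))

theorem mvfderiv_finset_sum {ι : Type*} (t : Finset ι) {g : ι → S → ℝ} {p : S}
    (hg : ∀ i ∈ t, MDifferentiableAt (𝓡 2) 𝓘(ℝ, ℝ) (g i) p) :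
    mvfderiv (𝓡 2) (fun q ↦ ∑ i ∈ t, g i q) p = ∑ i ∈ t, mvfderiv (𝓡 2) (g i) p := by
  classical
  induction t using Finset.induction_on with
  | empty => simp [mvfderiv_const]
  | insert a t ha ih =>
    have h1 := hg a (Finset.mem_insert_self a t)
    have h2 : ∀ i ∈ t, MDifferentiableAt (𝓡 2) 𝓘(ℝ, ℝ) (g i) p :=
      fun i hi ↦ hg i (Finset.mem_insert_of_mem hi)
    simp only [Finset.sum_insert ha]
    rw [mvfderiv_fun_add h1 (mdifferentiableAt_finset_sum t h2), ih h2]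

theorem mvfderiv_congr_of_eventuallyEq {E : Type*} [NormedAddCommGroup E] [NormedSpace ℝ E]
    {g g' : S → E} {p : S} (h : g =ᶠ[𝓝 p] g') (u : TangentSpace (𝓡 2) p) :
    mvfderiv (𝓡 2) g p u = mvfderiv (𝓡 2) g' p u := by
  simp only [mvfderiv, ContinuousLinearMap.comp_apply, h.mfderiv_eq]
  rfl

/-- The coordinate components of `mvfderiv` of a map to Euclidean space. -/
theorem mvfderiv_euclidean_apply {n : ℕ} {v : S → EuclideanSpace ℝ (Fin n)} {p : S}
    (hv : MDifferentiableAt (𝓡 2) 𝓘(ℝ, EuclideanSpace ℝ (Fin n)) v p) (u : TangentSpace (𝓡 2) p)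
    (i : Fin n) :
    mvfderiv (𝓡 2) (fun q ↦ v q i) p u = mvfderiv (𝓡 2) v p u i := by
  have h : HasMFDerivAt 𝓘(ℝ, EuclideanSpace ℝ (Fin n)) 𝓘(ℝ, ℝ)
      (EuclideanSpace.proj i : EuclideanSpace ℝ (Fin n) →L[ℝ] ℝ) (v p)
      (EuclideanSpace.proj i : EuclideanSpace ℝ (Fin n) →L[ℝ] ℝ) :=
    (EuclideanSpace.proj i : EuclideanSpace ℝ (Fin n) →L[ℝ] ℝ).hasMFDerivAt
  have h' := (h.comp p hv.hasMFDerivAt).mfderiv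
  simp only [mvfderiv, ContinuousLinearMap.comp_apply]
  change _ = EuclideanSpace.proj i _
  have h2 := congrArg (fun L ↦ L u) h'
  exact h2

theorem mdifferentiableAt_euclidean_apply {n : ℕ} {v : S → EuclideanSpace ℝ (Fin n)} {p : S}
    (hv : MDifferentiableAt (𝓡 2) 𝓘(ℝ, EuclideanSpace ℝ (Fin n)) v p) (i : Fin n) :
    MDifferentiableAt (𝓡 2) 𝓘(ℝ, ℝ) (fun q ↦ v q i) p :=
  ((EuclideanSpace.proj i : EuclideanSpace ℝ (Fin n) →L[ℝ] ℝ).differentiableAt).comp_mdifferentiableAt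
    hv

variable [IsManifold (𝓡 7) ∞ X]

/-- The vector field with constant coordinates `c` in the trivialization of `TX` around `x₀`. -/
noncomputable def coordField (x₀ : X) (c : R7) (y : X) : TangentSpace (𝓡 7) y :=
  (trivializationAt R7 (fun x : X ↦ TangentSpace (𝓡 7) x) x₀).symm y c

theorem mem_baseSet_self (x₀ : X) :
    x₀ ∈ (trivializationAt R7 (fun x : X ↦ TangentSpace (𝓡 7) x) x₀).baseSet :=
  FiberBundle.mem_baseSet_trivializationAt' x₀

theorem eventually_mem_baseSet (x₀ : X) :
    ∀ᶠ y in 𝓝 x₀, y ∈ (trivializationAt R7 (fun x : X ↦ TangentSpace (𝓡 7) x) x₀).baseSet :=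
  (trivializationAt R7 (fun x : X ↦ TangentSpace (𝓡 7) x) x₀).open_baseSet.mem_nhds
    (mem_baseSet_self x₀)

theorem coordField_eq_symmL {x₀ y : X}
    (hy : y ∈ (trivializationAt R7 (fun x : X ↦ TangentSpace (𝓡 7) x) x₀).baseSet) (c : R7) :
    coordField x₀ c y = (trivializationAt R7 (fun x : X ↦ TangentSpace (𝓡 7) x) x₀).symmL ℝ y c :=
  (Trivialization.symmL_apply _ hy c).symm

theorem coordField_eq_sum {x₀ y : X}
    (hy : y ∈ (trivializationAt R7 (fun x : X ↦ TangentSpace (𝓡 7) x) x₀).baseSet) (c : R7) :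
    coordField x₀ c y = ∑ i, c i • coordField x₀ (EuclideanSpace.single i 1) y := by
  have h : c = ∑ i, c i • EuclideanSpace.single i (1 : ℝ) := by
    ext j; simp [Finset.sum_apply, Pi.single_apply]
  simp only [coordField_eq_symmL hy]
  conv_lhs => rw [h]
  simp only [map_sum, map_smul]

theorem contMDiffAt_coordField (x₀ : X) (c : R7) :
    ContMDiffAt (𝓡 7) (𝓡 7).tangent ∞
      (fun y ↦ (⟨y, coordField x₀ c y⟩ : TangentBundle (𝓡 7) X)) x₀ := by
  rw [(trivializationAt R7 (fun x : X ↦ TangentSpace (𝓡 7) x) x₀).contMDiffAt_section_iff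
    (mem_baseSet_self x₀)]
  refine (contMDiffAt_const (c := c)).congr_of_eventuallyEq ?_
  filter_upwards [eventually_mem_baseSet x₀] with y hy
  simp [coordField, Trivialization.apply_mk_symm _ hy]

/-- The coordinates at `q` of a vector field along `f` in the trivialization of `TX` around
`f p`. -/
noncomputable def coordAlong (f : S → X) (V : ∀ q : S, TangentSpace (𝓡 7) (f q)) (p q : S) : R7 :=
  (trivializationAt R7 (fun x : X ↦ TangentSpace (𝓡 7) x) (f p) ⟨f q, V q⟩).2

/-- A vector field along `f` which is differentiable at `p`. -/
def MDifferentiableAlongAt (f : S → X) (V : ∀ q : S, TangentSpace (𝓡 7) (f q)) (p : S) : Prop :=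
  MDifferentiableAt (𝓡 2) (𝓡 7).tangent (fun q ↦ (⟨f q, V q⟩ : TangentBundle (𝓡 7) X)) p

theorem coordField_coordAlong (f : S → X) (V : ∀ q : S, TangentSpace (𝓡 7) (f q)) {p q : S}
    (hq : f q ∈ (trivializationAt R7 (fun x : X ↦ TangentSpace (𝓡 7) x) (f p)).baseSet) :
    coordField (f p) (coordAlong f V p q) (f q) = V q :=
  Trivialization.symm_proj_apply _ (⟨f q, V q⟩ : TangentBundle (𝓡 7) X) hq

variable {f : S → X} {p : S}

theorem eventually_mem_baseSet_along (hf : MDifferentiableAt (𝓡 2) (𝓡 7) f p) : ∀ᶠ q in 𝓝 p,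
    f q ∈ (trivializationAt R7 (fun x : X ↦ TangentSpace (𝓡 7) x) (f p)).baseSet :=
  hf.continuousAt.eventually (eventually_mem_baseSet (f p))

theorem mdifferentiableAlongAt_iff {V : ∀ q : S, TangentSpace (𝓡 7) (f q)}
    (hf : MDifferentiableAt (𝓡 2) (𝓡 7) f p) :
    MDifferentiableAlongAt f V p ↔
      MDifferentiableAt (𝓡 2) 𝓘(ℝ, R7) (coordAlong f V p) p := by
  rw [MDifferentiableAlongAt, mdifferentiableAt_totalSpace]
  exact and_iff_right hf

theorem MDifferentiableAlongAt.congr {V W : ∀ q : S, TangentSpace (𝓡 7) (f q)}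
    (hV : MDifferentiableAlongAt f V p) (h : ∀ᶠ q in 𝓝 p, W q = V q) :
    MDifferentiableAlongAt f W p :=
  MDifferentiableAt.congr_of_eventuallyEq hV <| by
    filter_upwards [h] with q hq
    rw [hq]

theorem coordAlong_of_mem {V : ∀ q : S, TangentSpace (𝓡 7) (f q)} {q : S}
    (hq : f q ∈ (trivializationAt R7 (fun x : X ↦ TangentSpace (𝓡 7) x) (f p)).baseSet) :
    coordAlong f V p q = (trivializationAt R7 (fun x : X ↦ TangentSpace (𝓡 7) x)
      (f p)).continuousLinearEquivAt ℝ (f q) hq (V q) := rfl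

theorem MDifferentiableAlongAt.add {V W : ∀ q : S, TangentSpace (𝓡 7) (f q)}
    (hf : MDifferentiableAt (𝓡 2) (𝓡 7) f p)
    (hV : MDifferentiableAlongAt f V p) (hW : MDifferentiableAlongAt f W p) :
    MDifferentiableAlongAt f (fun q ↦ V q + W q) p := by
  rw [mdifferentiableAlongAt_iff hf] at *
  refine (MDifferentiableAt.add hV hW).congr_of_eventuallyEq ?_
  filter_upwards [eventually_mem_baseSet_along hf] with q hq
  simp only [coordAlong_of_mem hq, map_add, Pi.add_apply]

theorem MDifferentiableAlongAt.smul {a : S → ℝ} {V : ∀ q : S, TangentSpace (𝓡 7) (f q)}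
    (hf : MDifferentiableAt (𝓡 2) (𝓡 7) f p) (ha : MDifferentiableAt (𝓡 2) 𝓘(ℝ, ℝ) a p)
    (hV : MDifferentiableAlongAt f V p) :
    MDifferentiableAlongAt f (fun q ↦ a q • V q) p := by
  rw [mdifferentiableAlongAt_iff hf] at *
  refine (MDifferentiableAt.smul ha hV).congr_of_eventuallyEq ?_
  filter_upwards [eventually_mem_baseSet_along hf] with q hq
  simp only [coordAlong_of_mem hq, map_smul, Pi.smul_apply']

theorem MDifferentiableAlongAt.sub {V W : ∀ q : S, TangentSpace (𝓡 7) (f q)}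
    (hf : MDifferentiableAt (𝓡 2) (𝓡 7) f p)
    (hV : MDifferentiableAlongAt f V p) (hW : MDifferentiableAlongAt f W p) :
    MDifferentiableAlongAt f (fun q ↦ V q - W q) p := by
  refine (hV.add hf (hW.smul hf (mdifferentiableAt_const (c := (-1 : ℝ))))).congr
    (.of_forall fun q ↦ ?_)
  simp [sub_eq_add_neg]

theorem mdifferentiableAlongAt_coordField (hf : MDifferentiableAt (𝓡 2) (𝓡 7) f p) (c : R7) :
    MDifferentiableAlongAt f (fun q ↦ coordField (f p) c (f q)) p :=
  MDifferentiableAt.comp (I' := 𝓡 7) p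
    ((contMDiffAt_coordField (f p) c).mdifferentiableAt (by simp)) hf

theorem MDifferentiableAlongAt.finset_sum {ι : Type*} (t : Finset ι)
    {V : ι → ∀ q : S, TangentSpace (𝓡 7) (f q)} (hf : MDifferentiableAt (𝓡 2) (𝓡 7) f p)
    (hV : ∀ i ∈ t, MDifferentiableAlongAt f (V i) p) :
    MDifferentiableAlongAt f (fun q ↦ ∑ i ∈ t, V i q) p := by
  classical
  induction t using Finset.induction_on with
  | empty =>
    refine (mdifferentiableAlongAt_coordField hf 0).congr ?_
    filter_upwards [eventually_mem_baseSet_along hf] with q hq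
    simp [coordField_eq_symmL hq]
  | insert a t ha ih =>
    simp only [Finset.sum_insert ha]
    exact (hV a (Finset.mem_insert_self a t)).add hf
      (ih fun i hi ↦ hV i (Finset.mem_insert_of_mem hi))

/-- The coordinate frame around `x₀` is a basis of each nearby tangent space. -/
theorem linearIndependent_coordField {x₀ y : X}
    (hy : y ∈ (trivializationAt R7 (fun x : X ↦ TangentSpace (𝓡 7) x) x₀).baseSet) :
    LinearIndependent ℝ fun i : Fin 7 ↦
      coordField x₀ (EuclideanSpace.single i (1 : ℝ)) y := by
  have h := (EuclideanSpace.basisFun (Fin 7) ℝ).toBasis.linearIndependent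
  have h2 := h.map' ((trivializationAt R7 (fun x : X ↦ TangentSpace (𝓡 7) x)
    x₀).continuousLinearEquivAt ℝ y hy).symm.toLinearEquiv.toLinearMap (by simp)
  convert h2 using 2 with i
  simp [coordField]
  rfl

variable [RiemannianBundle (fun x : X ↦ TangentSpace (𝓡 7) x)]
  [IsContMDiffRiemannianBundle (𝓡 7) ∞ R7 (fun x : X ↦ TangentSpace (𝓡 7) x)]

theorem MDifferentiableAlongAt.inner {V W : ∀ q : S, TangentSpace (𝓡 7) (f q)}
    (hV : MDifferentiableAlongAt f V p) (hW : MDifferentiableAlongAt f W p) :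
    MDifferentiableAt (𝓡 2) 𝓘(ℝ, ℝ) (fun q ↦ ⟪V q, W q⟫_ℝ) p :=
  haveI : IsContMDiffRiemannianBundle (𝓡 7) 1 R7 (fun x : X ↦ TangentSpace (𝓡 7) x) :=
    IsContMDiffRiemannianBundle.of_le (n := ∞) (by simp)
  MDifferentiableAt.inner_bundle (IB := 𝓡 7) (F := R7) hV hW

/-- The Gram-Schmidt orthogonalization of the coordinate frame around `f p`, along `f`. -/
noncomputable def orthoFrame (f : S → X) (p : S) (i : Fin 7) (q : S) : TangentSpace (𝓡 7) (f q) :=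
  InnerProductSpace.gramSchmidt ℝ
    (fun j : Fin 7 ↦ coordField (f p) (EuclideanSpace.single j (1 : ℝ)) (f q)) i

theorem orthoFrame_ne_zero {q : S} (i : Fin 7)
    (hq : f q ∈ (trivializationAt R7 (fun x : X ↦ TangentSpace (𝓡 7) x) (f p)).baseSet) :
    orthoFrame f p i q ≠ 0 :=
  InnerProductSpace.gramSchmidt_ne_zero i (linearIndependent_coordField hq)

theorem mdifferentiableAlongAt_orthoFrame (hf : MDifferentiableAt (𝓡 2) (𝓡 7) f p) (i : Fin 7) :
    MDifferentiableAlongAt f (orthoFrame f p i) p := by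
  induction i using WellFoundedLT.induction with
  | _ i ih =>
    -- Without normalization, each vector is a coordinate field minus a combination of earlier frame
    -- vectors, so strong induction applies. The only divisions are by squared lengths, which do not
    -- vanish at `p`.
    have h : ∀ q, orthoFrame f p i q = coordField (f p) (EuclideanSpace.single i (1 : ℝ)) (f q) -
        ∑ j ∈ Finset.Iio i, (⟪orthoFrame f p j q,
          coordField (f p) (EuclideanSpace.single i (1 : ℝ)) (f q)⟫_ℝ *
            (⟪orthoFrame f p j q, orthoFrame f p j q⟫_ℝ)⁻¹) • orthoFrame f p j q := by
      intro q
      rw [eq_sub_iff_add_eq]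
      refine ((InnerProductSpace.gramSchmidt_def'' ℝ (fun j : Fin 7 ↦
        coordField (f p) (EuclideanSpace.single j (1 : ℝ)) (f q)) i).trans ?_).symm
      simp only [real_inner_self_eq_norm_sq, orthoFrame, div_eq_mul_inv]
      rfl
    have hE := mdifferentiableAlongAt_coordField hf (EuclideanSpace.single i (1 : ℝ))
    refine MDifferentiableAlongAt.congr (hE.sub hf (.finset_sum _ hf fun j hj ↦ ?_))
      (.of_forall h)
    have hj' := ih j (Finset.mem_Iio.1 hj)
    refine hj'.smul hf ((hj'.inner hE).mul ((hj'.inner hj').inv ?_))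
    rw [real_inner_self_eq_norm_sq]
    exact pow_ne_zero _ (norm_ne_zero_iff.2 (orthoFrame_ne_zero j (mem_baseSet_self (f p))))

theorem sum_orthoFrame {q : S} (v : TangentSpace (𝓡 7) (f q))
    (hq : f q ∈ (trivializationAt R7 (fun x : X ↦ TangentSpace (𝓡 7) x) (f p)).baseSet) :
    v = ∑ i, (⟪v, orthoFrame f p i q⟫_ℝ * (⟪orthoFrame f p i q, orthoFrame f p i q⟫_ℝ)⁻¹) •
      orthoFrame f p i q := by
  have h := fun hli hc ↦ eq_sum_gramSchmidt (E := TangentSpace (𝓡 7) (f q))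
    (e := fun j : Fin 7 ↦ coordField (f p) (EuclideanSpace.single j (1 : ℝ)) (f q)) hli hc v
  refine h (linearIndependent_coordField hq) ?_
  change finrank ℝ R7 = 7
  simp

/-- A vector field along `f` is differentiable as soon as its scalar products with differentiable
vector fields along `f` are. -/
theorem mdifferentiableAlongAt_of_inner {V : ∀ q : S, TangentSpace (𝓡 7) (f q)}
    (hf : MDifferentiableAt (𝓡 2) (𝓡 7) f p)
    (hV : ∀ C : ∀ q : S, TangentSpace (𝓡 7) (f q), MDifferentiableAlongAt f C p →
      MDifferentiableAt (𝓡 2) 𝓘(ℝ, ℝ) (fun q ↦ ⟪V q, C q⟫_ℝ) p) :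
    MDifferentiableAlongAt f V p := by
  have h : MDifferentiableAlongAt f (fun q ↦ ∑ i, (⟪V q, orthoFrame f p i q⟫_ℝ *
      (⟪orthoFrame f p i q, orthoFrame f p i q⟫_ℝ)⁻¹) • orthoFrame f p i q) p := by
    refine .finset_sum _ hf fun i _ ↦ ?_
    have hi := mdifferentiableAlongAt_orthoFrame hf i
    refine hi.smul hf ((hV _ hi).mul ((hi.inner hi).inv ?_))
    rw [real_inner_self_eq_norm_sq]
    exact pow_ne_zero _ (norm_ne_zero_iff.2 (orthoFrame_ne_zero i (mem_baseSet_self (f p))))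
  refine h.congr ?_
  filter_upwards [eventually_mem_baseSet_along hf] with q hq
  exact sum_orthoFrame (V q) hq

end Along

/-! ### The pull-back connection and its product rules -/

section CovAlong

variable {X : Type*} [TopologicalSpace X] [ChartedSpace R7 X] [IsManifold (𝓡 7) ∞ X]
  {S : Type*} [TopologicalSpace S] [ChartedSpace R2 S]
  {nabla : CovariantDerivative (𝓡 7) R7 (fun x : X ↦ TangentSpace (𝓡 7) x)}
  {f : S → X} {p : S}

theorem mdifferentiableAt_coordField (x₀ : X) (c : R7) :
    MDifferentiableAt (𝓡 7) (𝓡 7).tangent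
      (fun y ↦ (⟨y, coordField x₀ c y⟩ : TangentBundle (𝓡 7) X)) x₀ :=
  (contMDiffAt_coordField x₀ c).mdifferentiableAt (by simp)

variable (nabla) in
/-- The covariant derivative at `x₀` of the coordinate fields around `x₀`. -/
noncomputable def christoffel (x₀ : X) (ξ : TangentSpace (𝓡 7) x₀) :
    R7 →ₗ[ℝ] TangentSpace (𝓡 7) x₀ where
  toFun c := nabla (coordField x₀ c) x₀ ξ
  map_add' c d := by
    have hc := mdifferentiableAt_coordField x₀ c
    have hd := mdifferentiableAt_coordField x₀ d
    rw [← add_apply, ← nabla.isCovariantDerivativeOnUniv.add hc hd]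
    -- The linear dependence of a coordinate field on its coordinates is checked near `x₀` only; a
    -- covariant derivative at `x₀` depends only on the germ of the section.
    refine congrArg (fun L ↦ L ξ) (nabla.isCovariantDerivativeOnUniv.congr_of_eventuallyEq
      (mdifferentiableAt_coordField x₀ _) (mdifferentiableAt_add_section hc hd)
      Filter.univ_mem ?_)
    filter_upwards [eventually_mem_baseSet x₀] with y hy
    simp [coordField_eq_symmL hy]
  map_smul' a c := by
    have hc := mdifferentiableAt_coordField x₀ c
    have ha : MDifferentiableAt (𝓡 7) 𝓘(ℝ, ℝ) (fun _ : X ↦ a) x₀ := mdifferentiableAt_const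
    have h : nabla (coordField x₀ (a • c)) x₀ = nabla ((fun _ : X ↦ a) • coordField x₀ c) x₀ := by
      refine nabla.isCovariantDerivativeOnUniv.congr_of_eventuallyEq
        (mdifferentiableAt_coordField x₀ _) (MDifferentiableAt.smul_section ha hc)
        Filter.univ_mem ?_
      filter_upwards [eventually_mem_baseSet x₀] with y hy
      simp [coordField_eq_symmL hy]
    rw [h, nabla.isCovariantDerivativeOnUniv.leibniz hc ha]
    simp [mvfderiv_const]

theorem covAlong_apply (V : ∀ q : S, TangentSpace (𝓡 7) (f q)) (u : TangentSpace (𝓡 2) p) :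
    covAlong nabla f V p u =
      coordField (f p) (mvfderiv (𝓡 2) (coordAlong f V p) p u) (f p) +
        christoffel nabla (f p) (mfderiv (𝓡 2) (𝓡 7) f p u) (coordAlong f V p p) := by
  rw [coordField_eq_symmL (mem_baseSet_self (f p))]
  rfl

theorem exists_mdifferentiableAlongAt_eq (hf : MDifferentiableAt (𝓡 2) (𝓡 7) f p)
    (c : TangentSpace (𝓡 7) (f p)) :
    ∃ C : ∀ q : S, TangentSpace (𝓡 7) (f q), MDifferentiableAlongAt f C p ∧ C p = c := by
  refine ⟨_, mdifferentiableAlongAt_coordField hf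
    ((trivializationAt R7 (fun x : X ↦ TangentSpace (𝓡 7) x) (f p)).continuousLinearMapAt ℝ
      (f p) c), ?_⟩
  rw [coordField_eq_symmL (mem_baseSet_self (f p)),
    Trivialization.symmL_continuousLinearMapAt _ (mem_baseSet_self (f p))]

/-- The coordinates of a vector field along `f`. -/
theorem eq_sum_coordField {V : ∀ q : S, TangentSpace (𝓡 7) (f q)} {q : S}
    (hq : f q ∈ (trivializationAt R7 (fun x : X ↦ TangentSpace (𝓡 7) x) (f p)).baseSet) :
    V q = ∑ i, coordAlong f V p q i • coordField (f p) (EuclideanSpace.single i 1) (f q) := by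
  rw [← coordField_eq_sum hq, coordField_coordAlong f V hq]

theorem covAlong_eq_sum {V : ∀ q : S, TangentSpace (𝓡 7) (f q)}
    (hf : MDifferentiableAt (𝓡 2) (𝓡 7) f p) (hV : MDifferentiableAlongAt f V p)
    (u : TangentSpace (𝓡 2) p) :
    covAlong nabla f V p u = ∑ i,
      (mvfderiv (𝓡 2) (fun q ↦ coordAlong f V p q i) p u •
          coordField (f p) (EuclideanSpace.single i 1) (f p) +
        coordAlong f V p p i • nabla (coordField (f p) (EuclideanSpace.single i 1)) (f p)
          (mfderiv (𝓡 2) (𝓡 7) f p u)) := by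
  rw [mdifferentiableAlongAt_iff hf] at hV
  have h : coordAlong f V p p = ∑ i, coordAlong f V p p i • EuclideanSpace.single i (1 : ℝ) := by
    ext j; simp [Finset.sum_apply, Pi.single_apply]
  rw [covAlong_apply, coordField_eq_sum (mem_baseSet_self (f p)), Finset.sum_add_distrib]
  congr 1
  · simp only [mvfderiv_euclidean_apply hV]
  · conv_lhs => rw [h]
    simp only [map_sum, map_smul]
    rfl

/-- A Leibniz rule for pairing with a field of linear forms along `f` has to be checked on the
coordinate fields only. -/
theorem mvfderiv_apply_of_coordField {V : ∀ q : S, TangentSpace (𝓡 7) (f q)}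
    (hf : MDifferentiableAt (𝓡 2) (𝓡 7) f p) (hV : MDifferentiableAlongAt f V p)
    {u : TangentSpace (𝓡 2) p} (l : ∀ q : S, TangentSpace (𝓡 7) (f q) →ₗ[ℝ] ℝ)
    (m : TangentSpace (𝓡 7) (f p) →ₗ[ℝ] ℝ)
    (hl : ∀ c, MDifferentiableAt (𝓡 2) 𝓘(ℝ, ℝ) (fun q ↦ l q (coordField (f p) c (f q))) p ∧
      mvfderiv (𝓡 2) (fun q ↦ l q (coordField (f p) c (f q))) p u =
        l p (nabla (coordField (f p) c) (f p) (mfderiv (𝓡 2) (𝓡 7) f p u)) +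
          m (coordField (f p) c (f p))) :
    MDifferentiableAt (𝓡 2) 𝓘(ℝ, ℝ) (fun q ↦ l q (V q)) p ∧
      mvfderiv (𝓡 2) (fun q ↦ l q (V q)) p u = l p (covAlong nabla f V p u) + m (V p) := by
  -- Near `p` the pairing is a finite sum of real functions, coordinates of `V` times `l` on the
  -- frame. The ordinary product rule applied to each term reproduces the two kinds of terms in
  -- `covAlong_eq_sum`.
  have heq : (fun q ↦ l q (V q)) =ᶠ[𝓝 p] fun q ↦ ∑ i, coordAlong f V p q i *
      l q (coordField (f p) (EuclideanSpace.single i 1) (f q)) := by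
    filter_upwards [eventually_mem_baseSet_along hf] with q hq
    conv_lhs => rw [eq_sum_coordField (V := V) hq]
    simp
  have hv (i) : MDifferentiableAt (𝓡 2) 𝓘(ℝ, ℝ) (fun q ↦ coordAlong f V p q i) p :=
    mdifferentiableAt_euclidean_apply ((mdifferentiableAlongAt_iff hf).1 hV) i
  have hvl (i) : MDifferentiableAt (𝓡 2) 𝓘(ℝ, ℝ) (fun q ↦ coordAlong f V p q i *
      l q (coordField (f p) (EuclideanSpace.single i 1) (f q))) p := (hv i).mul (hl _).1
  refine ⟨(mdifferentiableAt_finset_sum _ fun i _ ↦ hvl i).congr_of_eventuallyEq heq, ?_⟩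
  rw [mvfderiv_congr_of_eventuallyEq heq, mvfderiv_finset_sum _ fun i _ ↦ hvl i,
    covAlong_eq_sum hf hV]
  conv_rhs => enter [2]; rw [eq_sum_coordField (V := V) (mem_baseSet_self (f p))]
  rw [map_sum, map_sum, ← Finset.sum_add_distrib, sum_apply]
  refine Finset.sum_congr rfl fun i _ ↦ ?_
  rw [mvfderiv_fun_mul (hv i) (hl _).1, add_apply,
    smul_apply, smul_apply, (hl _).2]
  simp only [map_add, map_smul, smul_eq_mul]
  ring

variable [RiemannianBundle (fun x : X ↦ TangentSpace (𝓡 7) x)]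

section Form

variable {G : G2Structure X} {A B C : ∀ q : S, TangentSpace (𝓡 7) (f q)}

/-- For three coordinate fields this is `∇φ = 0` composed with `df` by the chain rule. The
coordinate fields are then replaced by arbitrary fields along `f` one slot at a time, `φ` being
regarded each time as a linear form in that slot. Differentiability is carried along with the
formula, since `φ` is only known to be smooth on smooth fields of `X`. -/
theorem mvfderiv_form (hf : MDifferentiableAt (𝓡 2) (𝓡 7) f p) (hG : G.IsParallel nabla)
    (hA : MDifferentiableAlongAt f A p) (hB : MDifferentiableAlongAt f B p)
    (hC : MDifferentiableAlongAt f C p) (u : TangentSpace (𝓡 2) p) :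
    MDifferentiableAt (𝓡 2) 𝓘(ℝ, ℝ) (fun q ↦ G.form (f q) (A q) (B q) (C q)) p ∧
      mvfderiv (𝓡 2) (fun q ↦ G.form (f q) (A q) (B q) (C q)) p u =
        G.form (f p) (covAlong nabla f A p u) (B p) (C p) +
          G.form (f p) (A p) (covAlong nabla f B p u) (C p) +
            G.form (f p) (A p) (B p) (covAlong nabla f C p u) := by
  have h0 (a b c : R7) : MDifferentiableAt (𝓡 2) 𝓘(ℝ, ℝ) (fun q ↦ G.form (f q)
      (coordField (f p) a (f q)) (coordField (f p) b (f q)) (coordField (f p) c (f q))) p ∧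
      mvfderiv (𝓡 2) (fun q ↦ G.form (f q)
      (coordField (f p) a (f q)) (coordField (f p) b (f q)) (coordField (f p) c (f q))) p u =
        G.form (f p) (nabla (coordField (f p) a) (f p) (mfderiv (𝓡 2) (𝓡 7) f p u))
            (coordField (f p) b (f p)) (coordField (f p) c (f p)) +
          G.form (f p) (coordField (f p) a (f p)) (nabla (coordField (f p) b) (f p)
            (mfderiv (𝓡 2) (𝓡 7) f p u)) (coordField (f p) c (f p)) +
          G.form (f p) (coordField (f p) a (f p)) (coordField (f p) b (f p))
            (nabla (coordField (f p) c) (f p) (mfderiv (𝓡 2) (𝓡 7) f p u)) := by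
    have hd : MDifferentiableAt (𝓡 7) 𝓘(ℝ, ℝ) (fun y ↦ G.form y (coordField (f p) a y)
        (coordField (f p) b y) (coordField (f p) c y)) (f p) :=
      (G.smooth (f p) _ _ _ (contMDiffAt_coordField _ a) (contMDiffAt_coordField _ b)
        (contMDiffAt_coordField _ c)).mdifferentiableAt (by simp)
    refine ⟨hd.comp p hf, (mvfderiv_comp_apply p hd hf u).trans ?_⟩
    exact hG (f p) _ _ _ (mdifferentiableAt_coordField _ a) (mdifferentiableAt_coordField _ b)
      (mdifferentiableAt_coordField _ c) _
  -- The form `m` collects the terms in which the derivative falls on the slots other than the one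
  -- being replaced.
  have h1 (b c : R7) := mvfderiv_apply_of_coordField (nabla := nabla) hf hA (u := u)
    (fun q ↦ ((G.form (f q)).flip (coordField (f p) b (f q))).flip (coordField (f p) c (f q)))
    (((G.form (f p)).flip (nabla (coordField (f p) b) (f p)
            (mfderiv (𝓡 2) (𝓡 7) f p u))).flip (coordField (f p) c (f p)) +
      ((G.form (f p)).flip (coordField (f p) b (f p))).flip
        (nabla (coordField (f p) c) (f p) (mfderiv (𝓡 2) (𝓡 7) f p u)))
    (fun a ↦ ⟨(h0 a b c).1, (h0 a b c).2.trans (by simp [add_assoc])⟩)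
  have h2 (c : R7) := mvfderiv_apply_of_coordField (nabla := nabla) hf hB (u := u)
    (fun q ↦ (G.form (f q) (A q)).flip (coordField (f p) c (f q)))
    ((G.form (f p) (covAlong nabla f A p u)).flip (coordField (f p) c (f p)) +
      (G.form (f p) (A p)).flip
        (nabla (coordField (f p) c) (f p) (mfderiv (𝓡 2) (𝓡 7) f p u)))
    (fun b ↦ ⟨(h1 b c).1, (h1 b c).2.trans (by simp; ring)⟩)
  have h3 := mvfderiv_apply_of_coordField (nabla := nabla) hf hC (u := u)
    (fun q ↦ G.form (f q) (A q) (B q))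
    (G.form (f p) (covAlong nabla f A p u) (B p) + G.form (f p) (A p) (covAlong nabla f B p u))
    (fun c ↦ ⟨(h2 c).1, (h2 c).2.trans (by simp; ring)⟩)
  exact ⟨h3.1, h3.2.trans (by simp; ring)⟩

end Form

variable [IsContMDiffRiemannianBundle (𝓡 7) ∞ R7 (fun x : X ↦ TangentSpace (𝓡 7) x)]

/-- The same slot-by-slot replacement as in `mvfderiv_form`, now with two slots and starting from
metric compatibility. -/
theorem mvfderiv_inner (hf : MDifferentiableAt (𝓡 2) (𝓡 7) f p) (hnabla : IsLeviCivita nabla)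
    {V W : ∀ q : S, TangentSpace (𝓡 7) (f q)}
    (hV : MDifferentiableAlongAt f V p) (hW : MDifferentiableAlongAt f W p)
    (u : TangentSpace (𝓡 2) p) :
    mvfderiv (𝓡 2) (fun q ↦ ⟪V q, W q⟫_ℝ) p u =
      ⟪covAlong nabla f V p u, W p⟫_ℝ + ⟪V p, covAlong nabla f W p u⟫_ℝ := by
  have : IsContMDiffRiemannianBundle (𝓡 7) 1 R7 (fun x : X ↦ TangentSpace (𝓡 7) x) :=
    IsContMDiffRiemannianBundle.of_le (n := ∞) (by simp)
  let L (x : X) (v : TangentSpace (𝓡 7) x) : TangentSpace (𝓡 7) x →ₗ[ℝ] ℝ :=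
    { toFun := fun w ↦ ⟪v, w⟫_ℝ
      map_add' := fun w w' ↦ inner_add_right v w w'
      map_smul' := fun r w ↦ inner_smul_right v w r }
  have hL (x : X) (v w : TangentSpace (𝓡 7) x) : L x v w = ⟪v, w⟫_ℝ := rfl
  have h0 (a b : R7) : MDifferentiableAt (𝓡 2) 𝓘(ℝ, ℝ)
      (fun q ↦ L (f q) (coordField (f p) a (f q)) (coordField (f p) b (f q))) p ∧
      mvfderiv (𝓡 2) (fun q ↦ L (f q) (coordField (f p) a (f q)) (coordField (f p) b (f q))) p u =
        L (f p) (coordField (f p) a (f p)) (nabla (coordField (f p) b) (f p)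
            (mfderiv (𝓡 2) (𝓡 7) f p u)) +
        L (f p) (nabla (coordField (f p) a) (f p) (mfderiv (𝓡 2) (𝓡 7) f p u))
            (coordField (f p) b (f p)) := by
    have hd : MDifferentiableAt (𝓡 7) 𝓘(ℝ, ℝ) (fun y ↦ L y (coordField (f p) a y)
        (coordField (f p) b y)) (f p) :=
      MDifferentiableAt.inner_bundle (IB := 𝓡 7) (F := R7)
        (E := fun x : X ↦ TangentSpace (𝓡 7) x) (mdifferentiableAt_coordField _ a)
        (mdifferentiableAt_coordField _ b)
    refine ⟨hd.comp p hf, (mvfderiv_comp_apply p hd hf u).trans ?_⟩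
    -- Metric compatibility is phrased with a direction field, so the direction `df(u)` is extended
    -- to one; only its value at `f p` matters.
    have h := CovariantDerivative.IsMetricCompatible.mvfderiv_inner_eq hnabla.1 (x := f p)
      (FiberBundle.extend R7 (mfderiv (𝓡 2) (𝓡 7) f p u))
      (mdifferentiableAt_coordField (f p) a) (mdifferentiableAt_coordField (f p) b)
    simp only [FiberBundle.extend_apply_self] at h
    exact h.trans (add_comm _ _)
  have h1 (a : R7) := mvfderiv_apply_of_coordField (nabla := nabla) hf hW (u := u)
    (fun q ↦ L (f q) (coordField (f p) a (f q)))
    (L (f p) (nabla (coordField (f p) a) (f p) (mfderiv (𝓡 2) (𝓡 7) f p u)))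
    (h0 a)
  have hsymm (x : X) (v w : TangentSpace (𝓡 7) x) : L x v w = L x w v := real_inner_comm w v
  have h2 := mvfderiv_apply_of_coordField (nabla := nabla) hf hV (u := u)
    (fun q ↦ L (f q) (W q)) (L (f p) (covAlong nabla f W p u))
    (fun a ↦ by
      simp only [hsymm _ (W _), hsymm _ (covAlong nabla f W p u)]
      exact ⟨(h1 a).1, (h1 a).2.trans (add_comm _ _)⟩)
  have h3 := h2.2
  simp only [hsymm _ (W _), hsymm _ (covAlong nabla f W p u)] at h3
  exact h3

variable {G : G2Structure X} {A B : ∀ q : S, TangentSpace (𝓡 7) (f q)}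

theorem MDifferentiableAlongAt.cross (hf : MDifferentiableAt (𝓡 2) (𝓡 7) f p)
    (hG : G.IsParallel nabla)
    (hA : MDifferentiableAlongAt f A p) (hB : MDifferentiableAlongAt f B p) :
    MDifferentiableAlongAt f (fun q ↦ G.cross (f q) (A q) (B q)) p := by
  refine mdifferentiableAlongAt_of_inner hf fun C hC ↦ ?_
  simp only [G.inner_cross]
  -- Only the differentiability half is needed, so the direction `0` is an arbitrary choice.
  exact (mvfderiv_form hf hG hA hB hC 0).1

/-- The Leibniz rule for the parallel cross product, in weak form. With `c` extended to a field `C`,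
the derivative of `⟪A × B, C⟫ = φ(A, B, C)` is computed from the metric and from `φ`; the terms
containing the derivative of `C` cancel. -/
theorem inner_covAlong_cross (hf : MDifferentiableAt (𝓡 2) (𝓡 7) f p) (hnabla : IsLeviCivita nabla)
    (hG : G.IsParallel nabla)
    (hA : MDifferentiableAlongAt f A p) (hB : MDifferentiableAlongAt f B p)
    (u : TangentSpace (𝓡 2) p) (c : TangentSpace (𝓡 7) (f p)) :
    ⟪covAlong nabla f (fun q ↦ G.cross (f q) (A q) (B q)) p u, c⟫_ℝ =
      G.form (f p) (covAlong nabla f A p u) (B p) c +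
        G.form (f p) (A p) (covAlong nabla f B p u) c := by
  obtain ⟨C, hC, rfl⟩ := exists_mdifferentiableAlongAt_eq hf c
  have h1 := mvfderiv_inner hf hnabla (hA.cross hf hG hB) hC u
  have h2 := (mvfderiv_form hf hG hA hB hC u).2
  simp only [G.inner_cross] at h1
  linarith

end CovAlong

/-! ### Algebra of the seven-dimensional cross product -/

namespace G2Structure

variable {X : Type*} [TopologicalSpace X] [ChartedSpace R7 X] [IsManifold (𝓡 7) ∞ X]
  [RiemannianBundle (fun x : X ↦ TangentSpace (𝓡 7) x)]
  (G : G2Structure X) (x : X)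

theorem cross_cross (a b : TangentSpace (𝓡 7) x) :
    G.cross x a (G.cross x a b) = ⟪a, b⟫_ℝ • a - ⟪a, a⟫_ℝ • b := by
  refine ext_inner_right ℝ fun v ↦ ?_
  rw [G.inner_cross, G.form_cross, inner_sub_left, inner_smul_left, inner_smul_left]
  simp

theorem cross_add_left (a b c : TangentSpace (𝓡 7) x) :
    G.cross x (a + b) c = G.cross x a c + G.cross x b c := by
  rw [G.cross_swap, map_add, neg_add, ← G.cross_swap, ← G.cross_swap]

theorem inner_cross_left (a b : TangentSpace (𝓡 7) x) : ⟪G.cross x a b, a⟫_ℝ = 0 := by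
  rw [G.inner_cross, G.form_self]

theorem inner_cross_right (a b : TangentSpace (𝓡 7) x) : ⟪G.cross x a b, b⟫_ℝ = 0 := by
  rw [G.inner_cross, G.form_cycle, G.form_cycle, G.form_self]

theorem inner_cross_cross (a b : TangentSpace (𝓡 7) x) :
    ⟪G.cross x a b, G.cross x a b⟫_ℝ = ⟪a, a⟫_ℝ * ⟪b, b⟫_ℝ - ⟪a, b⟫_ℝ * ⟪a, b⟫_ℝ := by
  rw [G.inner_cross, G.form_swap, G.form_cross]
  ring

/-- Polarization of `cross_cross` in the repeated argument: a Clifford-type relation from which the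
remaining identities follow. -/
theorem cross_cross_add (a b c : TangentSpace (𝓡 7) x) :
    G.cross x a (G.cross x b c) + G.cross x b (G.cross x a c) =
      ⟪a, c⟫_ℝ • b + ⟪b, c⟫_ℝ • a - (2 * ⟪a, b⟫_ℝ) • c := by
  have h := G.cross_cross x (a + b) c
  simp only [cross_add_left, map_add, cross_cross, inner_add_left, inner_add_right] at h
  rw [real_inner_comm a b] at h
  rw [← sub_eq_zero] at h ⊢
  rw [← h]
  module

variable {x}

/-- Cross product with `y` is self-adjoint for the restriction of `φ` to vectors orthogonal to
`y`. -/
theorem form_cross_comm {y a b c : TangentSpace (𝓡 7) x} (ha : ⟪y, a⟫_ℝ = 0) (hb : ⟪y, b⟫_ℝ = 0)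
    (hc : ⟪y, c⟫_ℝ = 0) : G.form x a (G.cross x y b) c = G.form x a b (G.cross x y c) := by
  -- Paired with `c`, every term on the right of the polarized identity vanishes by orthogonality to
  -- `y`; moving `y ×` across the inner product then turns the second term on the left into `-φ(a,
  -- b, y × c)`.
  have h := congrArg (fun v ↦ ⟪v, c⟫_ℝ) (G.cross_cross_add x a y b)
  simp only [inner_add_left, inner_sub_left, inner_smul_left, hb, hc, real_inner_comm y a, ha,
    G.inner_cross, conj_trivial] at h
  have h2 : G.form x y (G.cross x a b) c = - G.form x a b (G.cross x y c) := by
    rw [G.form_swap, ← G.inner_cross, real_inner_comm, G.inner_cross]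
  rw [h2] at h
  linarith

theorem cross_cross_left {y z w : TangentSpace (𝓡 7) x} (hy : ⟪y, w⟫_ℝ = 0) (hz : ⟪z, w⟫_ℝ = 0) :
    G.cross x (G.cross x y z) w = - G.cross x y (G.cross x z w) - ⟪y, z⟫_ℝ • w := by
  have h := G.cross_cross_add x w y z
  rw [real_inner_comm z w, real_inner_comm y w, hy, hz, G.cross_swap x w (G.cross x y z),
    G.cross_swap x w z, map_neg] at h
  rw [← sub_eq_zero] at h ⊢
  rw [← neg_eq_zero, ← h]
  module

/-- The three-form vanishes on the orthogonal complement of an associative three-plane. -/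
theorem form_eq_zero {y z a b c : TangentSpace (𝓡 7) x} (hn : G.cross x y z ≠ 0)
    (hya : ⟪y, a⟫_ℝ = 0) (hza : ⟪z, a⟫_ℝ = 0) (hna : ⟪G.cross x y z, a⟫_ℝ = 0)
    (hyb : ⟪y, b⟫_ℝ = 0) (hzb : ⟪z, b⟫_ℝ = 0) (hnb : ⟪G.cross x y z, b⟫_ℝ = 0)
    (hyc : ⟪y, c⟫_ℝ = 0) (hzc : ⟪z, c⟫_ℝ = 0) (hnc : ⟪G.cross x y z, c⟫_ℝ = 0) :
    G.form x a b c = 0 := by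
  -- With `n = y × z`, self-adjointness of `n ×` gives `φ(a, n × b, c) = φ(a, b, n × c)`. Writing `n
  -- ×` through `y ×` and `z ×`, moving these two across separately and using their anticommutation
  -- relation gives the same identity with the opposite sign, so both sides vanish.
  have key (b : TangentSpace (𝓡 7) x) (hyb : ⟪y, b⟫_ℝ = 0) (hzb : ⟪z, b⟫_ℝ = 0)
      (hnb : ⟪G.cross x y z, b⟫_ℝ = 0) : G.form x a (G.cross x (G.cross x y z) b) c = 0 := by
    have h1 := G.form_cross_comm hna hnb hnc
    have hyzb : ⟪y, G.cross x z b⟫_ℝ = 0 := by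
      rw [real_inner_comm, G.inner_cross, ← G.form_cycle, ← G.inner_cross, hnb]
    have hzyc : ⟪z, G.cross x y c⟫_ℝ = 0 := by
      rw [real_inner_comm, G.inner_cross, G.form_swap, ← G.inner_cross, hnc, neg_zero]
    have h2 := G.form_cross_comm hya hyzb hyc
    have h3 := G.form_cross_comm hza hzb hzyc
    have h4 : G.form x a (G.cross x (G.cross x y z) b) c =
        - G.form x a (G.cross x y (G.cross x z b)) c - ⟪y, z⟫_ℝ * G.form x a b c := by
      rw [G.cross_cross_left hyb hzb]; simp
    have h5 : G.form x a b (G.cross x (G.cross x y z) c) =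
        - G.form x a b (G.cross x y (G.cross x z c)) - ⟪y, z⟫_ℝ * G.form x a b c := by
      rw [G.cross_cross_left hyc hzc]; simp
    have h6 := congrArg (G.form x a b) (G.cross_cross_add x y z c)
    simp only [map_add, map_sub, map_smul, hyc, hzc, zero_smul, smul_eq_mul] at h6
    simp only [map_zero] at h6
    linarith
  -- On vectors orthogonal to `n`, applying `n ×` twice is multiplication by `-|n|²`, so `key` at `n
  -- × b` yields the claim for `b` itself.
  have h := key (G.cross x (G.cross x y z) b)
    (by rw [real_inner_comm, G.inner_cross, G.form_cycle, G.form_cycle, G.form_cross]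
        simp [hyb, hzb])
    (by rw [real_inner_comm, G.inner_cross, G.form_cycle, G.form_cycle, G.cross_swap, map_neg,
          LinearMap.neg_apply, G.form_cross]
        simp [hyb, hzb])
    (by rw [real_inner_comm, G.inner_cross_left])
  rw [G.cross_cross, hnb] at h
  simpa [hn] using h

/-- The cross product of two linearly independent vectors does not vanish. -/
theorem cross_ne_zero {y z : TangentSpace (𝓡 7) x}
    (h : ∀ r s : ℝ, r • y + s • z = 0 → r = 0 ∧ s = 0) : G.cross x y z ≠ 0 := by
  intro h0
  -- If `y × z = 0`, the double product identity becomes the linear relation `⟪y, z⟫ y - ⟪y, y⟫ z =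
  -- 0`, which forces `y = 0`.
  have h1 := G.cross_cross x y z
  rw [h0, map_zero] at h1
  have h2 := (h ⟪y, z⟫_ℝ (-⟪y, y⟫_ℝ) (by rw [h1]; module)).2
  have hy : y = 0 := inner_self_eq_zero.1 (neg_eq_zero.1 h2)
  simpa using (h 1 0 (by simp [hy])).1

end G2Structure

/-! ### Coordinate frames of the surface and the unit normal -/

section Frame

variable {X : Type*} [TopologicalSpace X] [ChartedSpace R7 X] [IsManifold (𝓡 7) ∞ X]
  {S : Type*} [TopologicalSpace S] [ChartedSpace R2 S] [IsManifold (𝓡 2) ∞ S]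

/-- The coordinate frame of a surface around `p`, at a point `q` of the chart around `p`. -/
noncomputable def surfaceFrame {p q : S}
    (hq : q ∈ (trivializationAt R2 (fun q : S ↦ TangentSpace (𝓡 2) q) p).baseSet) :
    Basis (Fin 2) ℝ (TangentSpace (𝓡 2) q) :=
  (EuclideanSpace.basisFun (Fin 2) ℝ).toBasis.map
    ((trivializationAt R2 (fun q : S ↦ TangentSpace (𝓡 2) q)
        p).continuousLinearEquivAt ℝ q hq).toLinearEquiv.symm

/-- The vector field with constant coordinates `c` in the trivialization of `TS` around `p`. -/
noncomputable def surfaceField (p : S) (c : R2) (q : S) : TangentSpace (𝓡 2) q :=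
  (trivializationAt R2 (fun q : S ↦ TangentSpace (𝓡 2) q) p).symm q c

theorem surfaceFrame_apply {p q : S}
    (hq : q ∈ (trivializationAt R2 (fun q : S ↦ TangentSpace (𝓡 2) q) p).baseSet) (i : Fin 2) :
    surfaceFrame hq i = surfaceField p (EuclideanSpace.single i 1) q := by
  simp [surfaceFrame, surfaceField]

theorem mem_surface_baseSet (p : S) :
    p ∈ (trivializationAt R2 (fun q : S ↦ TangentSpace (𝓡 2) q) p).baseSet :=
  FiberBundle.mem_baseSet_trivializationAt' p

theorem eventually_mem_surface_baseSet (p : S) : ∀ᶠ q in 𝓝 p,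
    q ∈ (trivializationAt R2 (fun q : S ↦ TangentSpace (𝓡 2) q) p).baseSet :=
  (trivializationAt R2 (fun q : S ↦ TangentSpace (𝓡 2) q) p).open_baseSet.mem_nhds
    (mem_surface_baseSet p)

theorem contMDiffAt_surfaceField (p : S) (c : R2) :
    ContMDiffAt (𝓡 2) (𝓡 2).tangent ∞
      (fun q ↦ (⟨q, surfaceField p c q⟩ : TangentBundle (𝓡 2) S)) p := by
  rw [(trivializationAt R2 (fun q : S ↦ TangentSpace (𝓡 2) q) p).contMDiffAt_section_iff
    (mem_surface_baseSet p)]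
  refine (contMDiffAt_const (c := c)).congr_of_eventuallyEq ?_
  filter_upwards [eventually_mem_surface_baseSet p] with y hy
  simp [surfaceField, Trivialization.apply_mk_symm _ hy]

theorem surfaceField_continuousLinearMapAt (p : S) (v : TangentSpace (𝓡 2) p) :
    surfaceField p ((trivializationAt R2 (fun q : S ↦ TangentSpace (𝓡 2) q)
      p).continuousLinearMapAt ℝ p v) p = v := by
  have h := Trivialization.symmL_continuousLinearMapAt (R := ℝ)
    (trivializationAt R2 (fun q : S ↦ TangentSpace (𝓡 2) q) p) (mem_surface_baseSet p) v
  rwa [Trivialization.symmL_apply _ (mem_surface_baseSet p)] at h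

theorem mdifferentiableAlongAt_mfderiv {f : S → X} {p : S} (hf : ContMDiff (𝓡 2) (𝓡 7) ∞ f)
    {Y : ∀ q : S, TangentSpace (𝓡 2) q}
    (hY : ContMDiffAt (𝓡 2) (𝓡 2).tangent ∞
      (fun q ↦ (⟨q, Y q⟩ : TangentBundle (𝓡 2) S)) p) :
    MDifferentiableAlongAt f (fun q ↦ mfderiv (𝓡 2) (𝓡 7) f q (Y q)) p := by
  have h : ContMDiff (𝓡 2).tangent (𝓡 7).tangent ∞ (tangentMap (𝓡 2) (𝓡 7) f) :=
    hf.contMDiff_tangentMap (by simp)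
  exact ((h _).comp p hY).mdifferentiableAt (by simp)

variable [RiemannianBundle (fun x : X ↦ TangentSpace (𝓡 7) x)]
  (G : G2Structure X) (o : SurfaceOrientation S) (f : S → X)

/-- The cross product of the images of the two coordinate fields around `p`. -/
noncomputable def coordNormal (p q : S) : TangentSpace (𝓡 7) (f q) :=
  G.cross (f q) (mfderiv (𝓡 2) (𝓡 7) f q (surfaceField p (EuclideanSpace.single 0 1) q))
    (mfderiv (𝓡 2) (𝓡 7) f q (surfaceField p (EuclideanSpace.single 1 1) q))

variable {f}

theorem coordNormal_ne_zero (himm : ∀ p : S, Function.Injective (mfderiv (𝓡 2) (𝓡 7) f p)) {p q : S}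
    (hq : q ∈ (trivializationAt R2 (fun q : S ↦ TangentSpace (𝓡 2) q) p).baseSet) :
    coordNormal G f p q ≠ 0 := by
  refine G.cross_ne_zero fun r s h ↦ ?_
  rw [← surfaceFrame_apply hq, ← surfaceFrame_apply hq, ← (mfderiv (𝓡 2) (𝓡 7) f q).map_smul,
    ← (mfderiv (𝓡 2) (𝓡 7) f q).map_smul, ← map_add] at h
  have h0 := himm q (h.trans (map_zero _).symm)
  have hli := Fintype.linearIndependent_iff.1 (surfaceFrame hq).linearIndependent ![r, s]
    (by simpa [Fin.sum_univ_two] using h0)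
  exact ⟨hli 0, hli 1⟩

theorem etaAux_eq_smul_coordNormal {p q : S}
    (hq : q ∈ (trivializationAt R2 (fun q : S ↦ TangentSpace (𝓡 2) q) p).baseSet) :
    etaAux G o f q = (surfaceFrame hq).det (orientedBasis o q) • coordNormal G f p q := by
  have hexp (j : Fin 2) : mfderiv (𝓡 2) (𝓡 7) f q (orientedBasis o q j) =
      (surfaceFrame hq).repr (orientedBasis o q j) 0 • mfderiv (𝓡 2) (𝓡 7) f q
        (surfaceFrame hq 0) + (surfaceFrame hq).repr (orientedBasis o q j) 1 •
          mfderiv (𝓡 2) (𝓡 7) f q (surfaceFrame hq 1) := by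
    conv_lhs => rw [← (surfaceFrame hq).sum_repr (orientedBasis o q j), Fin.sum_univ_two, map_add,
      map_smul, map_smul]
  rw [etaAux, hexp 0, hexp 1, G.cross_combination, coordNormal, ← surfaceFrame_apply hq,
    ← surfaceFrame_apply hq, Basis.det_apply, Matrix.det_fin_two]
  simp only [Basis.toMatrix_apply]
  congr 1
  ring

/-- Near `p`, the unit normal `η` is the normalized cross product of the coordinate fields, up to a
constant sign. -/
theorem exists_eta_eq (p : S) :
    ∃ σ : ℝ, σ * σ = 1 ∧ ∀ᶠ q in 𝓝 p,
      eta G o f q = (σ * ‖coordNormal G f p q‖⁻¹) • coordNormal G f p q := by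
  classical
  obtain ⟨o₀, ho₀⟩ := o.locally_constant p
  -- The sign compares the standard orientation of the model plane with the locally constant one, so
  -- it does not depend on `q`. This is where continuity of the orientation enters, and it is what
  -- makes `η` differentiable.
  let σ : ℝ := if (EuclideanSpace.basisFun (Fin 2) ℝ).toBasis.orientation = o₀ then 1 else -1
  refine ⟨σ, by simp only [σ]; split_ifs <;> norm_num, ?_⟩
  filter_upwards [ho₀, eventually_mem_surface_baseSet p] with q hoq hq
  have hdet : (surfaceFrame hq).det (orientedBasis o q) =
      (EuclideanSpace.basisFun (Fin 2) ℝ).toBasis.det ((orientedBasis o q).map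
        ((trivializationAt R2 (fun q : S ↦ TangentSpace (𝓡 2) q)
          p).continuousLinearEquivAt ℝ q hq).toLinearEquiv) := by
    rw [surfaceFrame, Basis.det_map]
    rfl
  have hor : ((orientedBasis o q).map ((trivializationAt R2 (fun q : S ↦ TangentSpace (𝓡 2) q)
      p).continuousLinearEquivAt ℝ q hq).toLinearEquiv).orientation = o₀ := by
    rw [Basis.orientation_map, ← hoq hq, orientedBasis, Orientation.someBasis_orientation]
  have hiff := Basis.orientation_eq_iff_det_pos (EuclideanSpace.basisFun (Fin 2) ℝ).toBasis
    ((orientedBasis o q).map ((trivializationAt R2 (fun q : S ↦ TangentSpace (𝓡 2) q)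
      p).continuousLinearEquivAt ℝ q hq).toLinearEquiv)
  rw [hor, ← hdet] at hiff
  have hne : (surfaceFrame hq).det (orientedBasis o q) ≠ 0 :=
    ((surfaceFrame hq).isUnit_det (orientedBasis o q)).ne_zero
  have hσ : (surfaceFrame hq).det (orientedBasis o q) =
      |(surfaceFrame hq).det (orientedBasis o q)| * σ := by
    simp only [σ]
    split_ifs with h
    · rw [abs_of_pos (hiff.1 h), mul_one]
    · rw [abs_of_nonpos (not_lt.1 fun h' ↦ h (hiff.2 h'))]
      ring
  have hpos := abs_pos.2 hne
  rw [eta, etaAux_eq_smul_coordNormal G o hq, norm_smul, Real.norm_eq_abs, smul_smul, mul_inv]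
  congr 1
  conv_lhs => enter [2]; rw [hσ]
  field_simp

end Frame

/-! ### The bundle `W` and its differentiable sections -/

section Main

variable {X : Type*} [TopologicalSpace X] [ChartedSpace R7 X] [IsManifold (𝓡 7) ∞ X]
  [RiemannianBundle (fun x : X ↦ TangentSpace (𝓡 7) x)]
  {S : Type*} [TopologicalSpace S] [ChartedSpace R2 S] [IsManifold (𝓡 2) ∞ S]
  {nabla : CovariantDerivative (𝓡 7) R7 (fun x : X ↦ TangentSpace (𝓡 7) x)}
  {G : G2Structure X} {o : SurfaceOrientation S} {f : S → X}

theorem inner_mfderiv_eta (p : S) (t : TangentSpace (𝓡 2) p) :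
    ⟪(mfderiv (𝓡 2) (𝓡 7) f p t : TangentSpace (𝓡 7) (f p)), eta G o f p⟫_ℝ = 0 := by
  rw [← (orientedBasis o p).sum_repr t, Fin.sum_univ_two, map_add, map_smul, map_smul,
    inner_add_left, inner_smul_left, inner_smul_left, eta, inner_smul_right, inner_smul_right,
    etaAux, real_inner_comm, G.inner_cross_left, real_inner_comm, G.inner_cross_right]
  simp

theorem inner_eta_self (himm : ∀ p : S, Function.Injective (mfderiv (𝓡 2) (𝓡 7) f p)) (p : S) :
    ⟪eta G o f p, eta G o f p⟫_ℝ = 1 := by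
  obtain ⟨σ, hσ, h⟩ := exists_eta_eq G o (f := f) p
  have hn := norm_ne_zero_iff.2 (coordNormal_ne_zero G himm (mem_surface_baseSet p))
  rw [h.self_of_nhds, inner_smul_left, inner_smul_right, real_inner_self_eq_norm_sq]
  simp only [conj_trivial]
  field_simp
  linarith

/-- Near `p`, membership in `W` can be tested against three differentiable fields instead of against
all tangent vectors and the normalized `η`. -/
theorem eventually_mem_bundleW (p : S) :
    ∀ᶠ q in 𝓝 p, ∀ v : TangentSpace (𝓡 7) (f q),
      ⟪mfderiv (𝓡 2) (𝓡 7) f q (surfaceField p (EuclideanSpace.single 0 1) q), v⟫_ℝ = 0 →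
      ⟪mfderiv (𝓡 2) (𝓡 7) f q (surfaceField p (EuclideanSpace.single 1 1) q), v⟫_ℝ = 0 →
      ⟪coordNormal G f p q, v⟫_ℝ = 0 → v ∈ bundleW G o f q := by
  obtain ⟨σ, hσ, h⟩ := exists_eta_eq G o (f := f) p
  filter_upwards [h, eventually_mem_surface_baseSet p] with q hη hq v h0 h1 hn
  rw [mem_bundleW, hη, inner_smul_left, hn, mul_zero]
  refine ⟨fun t ↦ ?_, rfl⟩
  rw [← (surfaceFrame hq).sum_repr t, Fin.sum_univ_two, map_add, map_smul, map_smul,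
    inner_add_left, inner_smul_left, inner_smul_left, surfaceFrame_apply, surfaceFrame_apply, h0,
    h1]
  simp

theorem inner_coordNormal_of_mem_bundleW
    (himm : ∀ p : S, Function.Injective (mfderiv (𝓡 2) (𝓡 7) f p)) {p : S}
    {v : TangentSpace (𝓡 7) (f p)} (hv : v ∈ bundleW G o f p) :
    ⟪coordNormal G f p p, v⟫_ℝ = 0 := by
  obtain ⟨σ, hσ, h⟩ := exists_eta_eq G o (f := f) p
  have hn := coordNormal_ne_zero G himm (mem_surface_baseSet p)
  have hσ0 : σ ≠ 0 := by rintro rfl; simp at hσ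
  have h1 := ((mem_bundleW G o f).1 hv).2
  rw [h.self_of_nhds, inner_smul_left] at h1
  simpa [hσ0, hn] using h1

/-- The three-form vanishes on `W`. -/
theorem form_eq_zero_of_mem_bundleW
    (himm : ∀ p : S, Function.Injective (mfderiv (𝓡 2) (𝓡 7) f p)) {p : S}
    {a b c : TangentSpace (𝓡 7) (f p)} (ha : a ∈ bundleW G o f p) (hb : b ∈ bundleW G o f p)
    (hc : c ∈ bundleW G o f p) : G.form (f p) a b c = 0 := by
  have hT {v : TangentSpace (𝓡 7) (f p)} (hv : v ∈ bundleW G o f p) :=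
    ((mem_bundleW G o f).1 hv).1
  exact G.form_eq_zero (coordNormal_ne_zero G himm (mem_surface_baseSet p))
    (hT ha _) (hT ha _) (inner_coordNormal_of_mem_bundleW himm ha)
    (hT hb _) (hT hb _) (inner_coordNormal_of_mem_bundleW himm hb)
    (hT hc _) (hT hc _) (inner_coordNormal_of_mem_bundleW himm hc)

variable [IsContMDiffRiemannianBundle (𝓡 7) ∞ R7 (fun x : X ↦ TangentSpace (𝓡 7) x)]

theorem mdifferentiableAlongAt_surfaceField (hf : ContMDiff (𝓡 2) (𝓡 7) ∞ f) (p : S) (c : R2) :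
    MDifferentiableAlongAt f (fun q ↦ mfderiv (𝓡 2) (𝓡 7) f q (surfaceField p c q)) p :=
  mdifferentiableAlongAt_mfderiv hf (contMDiffAt_surfaceField p c)

theorem mdifferentiableAlongAt_coordNormal (hG : G.IsParallel nabla)
    (hf : ContMDiff (𝓡 2) (𝓡 7) ∞ f) (p : S) :
    MDifferentiableAlongAt f (coordNormal G f p) p :=
  (mdifferentiableAlongAt_surfaceField hf p _).cross ((hf p).mdifferentiableAt (by simp)) hG
    (mdifferentiableAlongAt_surfaceField hf p _)

theorem mdifferentiableAlongAt_eta (hG : G.IsParallel nabla) (hf : ContMDiff (𝓡 2) (𝓡 7) ∞ f)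
    (himm : ∀ p : S, Function.Injective (mfderiv (𝓡 2) (𝓡 7) f p)) (p : S) :
    MDifferentiableAlongAt f (eta G o f) p := by
  obtain ⟨σ, hσ, h⟩ := exists_eta_eq G o (f := f) p
  have hd := mdifferentiableAlongAt_coordNormal hG hf p
  have hn := norm_ne_zero_iff.2 (coordNormal_ne_zero G himm (mem_surface_baseSet p))
  have hnorm : MDifferentiableAt (𝓡 2) 𝓘(ℝ, ℝ) (fun q ↦ ‖coordNormal G f p q‖) p := by
    simp only [norm_eq_sqrt_real_inner]
    refine DifferentiableAt.comp_mdifferentiableAt (g := Real.sqrt)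
      (Real.hasDerivAt_sqrt ?_).differentiableAt (hd.inner hd)
    rw [real_inner_self_eq_norm_sq]
    exact pow_ne_zero _ hn
  have hc : MDifferentiableAt (𝓡 2) 𝓘(ℝ, ℝ) (fun q ↦ σ * ‖coordNormal G f p q‖⁻¹) p :=
    (mdifferentiableAt_const (c := σ)).mul (hnorm.inv hn)
  exact (hd.smul ((hf p).mdifferentiableAt (by simp)) hc).congr h

/-- Every vector of `W` is the value of a section of `W` which is differentiable at its base
point. -/
theorem exists_section_bundleW (hG : G.IsParallel nabla) (hf : ContMDiff (𝓡 2) (𝓡 7) ∞ f)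
    (himm : ∀ p : S, Function.Injective (mfderiv (𝓡 2) (𝓡 7) f p)) {p : S}
    {w : TangentSpace (𝓡 7) (f p)} (hw : w ∈ bundleW G o f p) :
    ∃ s : ∀ q : S, bundleW G o f q, DifferentiableSectionAt G o f s p ∧
      (s p : TangentSpace (𝓡 7) (f p)) = w := by
  classical
  have hfp : MDifferentiableAt (𝓡 2) (𝓡 7) f p := (hf p).mdifferentiableAt (by simp)
  let y (q : S) : TangentSpace (𝓡 7) (f q) :=
    mfderiv (𝓡 2) (𝓡 7) f q (surfaceField p (EuclideanSpace.single 0 1) q)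
  let z (q : S) : TangentSpace (𝓡 7) (f q) :=
    mfderiv (𝓡 2) (𝓡 7) f q (surfaceField p (EuclideanSpace.single 1 1) q)
  let n (q : S) : TangentSpace (𝓡 7) (f q) := coordNormal G f p q
  have hn0 : n p ≠ 0 := coordNormal_ne_zero G himm (mem_surface_baseSet p)
  have hy : MDifferentiableAlongAt f y p := mdifferentiableAlongAt_surfaceField hf p _
  have hz : MDifferentiableAlongAt f z p := mdifferentiableAlongAt_surfaceField hf p _
  have hn : MDifferentiableAlongAt f n p := mdifferentiableAlongAt_coordNormal hG hf p
  obtain ⟨v, hv, hvp⟩ : ∃ v : ∀ q : S, TangentSpace (𝓡 7) (f q),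
      MDifferentiableAlongAt f v p ∧ v p = (⟪n p, n p⟫_ℝ)⁻¹ • w :=
    exists_mdifferentiableAlongAt_eq hfp _
  -- This is `|n|²` times the projection of `v` orthogonal to `y`, `z` and `n`. The coefficients of
  -- `y` and `z` come from Cramer's rule, whose Gram determinant is `|y|²|z|² - ⟪y, z⟫² = |n|²`, so
  -- no division occurs. The factor `|n|⁻²` in the value of `v` at `p` compensates for the scaling.
  let r (q : S) : TangentSpace (𝓡 7) (f q) := ⟪n q, n q⟫_ℝ • v q
    - (⟪z q, z q⟫_ℝ * ⟪y q, v q⟫_ℝ - ⟪y q, z q⟫_ℝ * ⟪z q, v q⟫_ℝ) • y q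
    - (⟪y q, y q⟫_ℝ * ⟪z q, v q⟫_ℝ - ⟪y q, z q⟫_ℝ * ⟪y q, v q⟫_ℝ) • z q
    - ⟪n q, v q⟫_ℝ • n q
  have hr : MDifferentiableAlongAt f r p := by
    refine (((hv.smul hfp (hn.inner hn)).sub hfp (hy.smul hfp ?_)).sub hfp
      (hz.smul hfp ?_)).sub hfp (hn.smul hfp (hn.inner hv))
    · exact ((hz.inner hz).mul (hy.inner hv)).sub ((hy.inner hz).mul (hz.inner hv))
    · exact ((hy.inner hy).mul (hz.inner hv)).sub ((hy.inner hz).mul (hy.inner hv))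
  have hrW : ∀ᶠ q in 𝓝 p, r q ∈ bundleW G o f q := by
    filter_upwards [eventually_mem_bundleW (G := G) (o := o) (f := f) p] with q hq
    have hnn : ⟪n q, n q⟫_ℝ = ⟪y q, y q⟫_ℝ * ⟪z q, z q⟫_ℝ - ⟪y q, z q⟫_ℝ * ⟪y q, z q⟫_ℝ :=
      G.inner_cross_cross (f q) (y q) (z q)
    have hny : ⟪n q, y q⟫_ℝ = 0 := G.inner_cross_left _ _ _
    have hnz : ⟪n q, z q⟫_ℝ = 0 := G.inner_cross_right _ _ _
    have hyn : ⟪y q, n q⟫_ℝ = 0 := by rw [real_inner_comm, hny]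
    have hzn : ⟪z q, n q⟫_ℝ = 0 := by rw [real_inner_comm, hnz]
    have hzy : ⟪z q, y q⟫_ℝ = ⟪y q, z q⟫_ℝ := real_inner_comm _ _
    refine hq (r q) ?_ ?_ ?_
    · change ⟪y q, r q⟫_ℝ = 0
      simp only [r, inner_sub_right, inner_smul_right, hyn]
      rw [hnn]
      ring
    · change ⟪z q, r q⟫_ℝ = 0
      simp only [r, inner_sub_right, inner_smul_right, hzn, hzy]
      rw [hnn]
      ring
    · change ⟪n q, r q⟫_ℝ = 0
      simp only [r, inner_sub_right, inner_smul_right, hny, hnz]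
      ring
  have hrp : r p = w := by
    have hT := ((mem_bundleW G o f).1 hw).1
    have hyv : ⟪y p, v p⟫_ℝ = 0 := by rw [hvp, inner_smul_right, hT, mul_zero]
    have hzv : ⟪z p, v p⟫_ℝ = 0 := by rw [hvp, inner_smul_right, hT, mul_zero]
    have hnv : ⟪n p, v p⟫_ℝ = 0 := by
      rw [hvp, inner_smul_right, inner_coordNormal_of_mem_bundleW himm hw, mul_zero]
    simp only [r, hyv, hzv, hnv, mul_zero, sub_zero, zero_smul]
    rw [hvp, smul_smul, mul_inv_cancel₀ (inner_self_ne_zero.2 hn0), one_smul]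
  -- A section must be defined on the whole surface; the value `0` is used where `r` is not known to
  -- lie in `W`, which does not happen near `p`.
  refine ⟨fun q ↦ if h : r q ∈ bundleW G o f q then ⟨r q, h⟩ else 0, ?_, ?_⟩
  · refine MDifferentiableAlongAt.congr hr ?_
    filter_upwards [hrW] with q hq
    rw [dif_pos hq]
  · simp only [hrp, dif_pos hw]

end Main

/-! ### The covariant derivative of `J` and the second fundamental form -/

section Main

variable {X : Type*} [TopologicalSpace X] [ChartedSpace R7 X] [IsManifold (𝓡 7) ∞ X]
  [RiemannianBundle (fun x : X ↦ TangentSpace (𝓡 7) x)]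
  {S : Type*} [TopologicalSpace S] [ChartedSpace R2 S] [IsManifold (𝓡 2) ∞ S]
  {nabla : CovariantDerivative (𝓡 7) R7 (fun x : X ↦ TangentSpace (𝓡 7) x)}
  {G : G2Structure X} {o : SurfaceOrientation S} {f : S → X}

/-- Pairing with vectors of `W` does not see the projection, so computations with `∇^W` reduce to
the pull-back connection. -/
theorem inner_connectionW (s : ∀ q : S, bundleW G o f q) (p : S) (u : TangentSpace (𝓡 2) p)
    {w : TangentSpace (𝓡 7) (f p)} (hw : w ∈ bundleW G o f p) :
    ⟪(connectionW G o f nabla s p u : TangentSpace (𝓡 7) (f p)), w⟫_ℝ =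
      ⟪covAlong nabla f (fun q ↦ (s q : TangentSpace (𝓡 7) (f q))) p u, w⟫_ℝ :=
  Submodule.inner_orthogonalProjectionOnto_eq_of_mem_right ⟨w, hw⟩ _

/-- A dimension count: `W` is the orthogonal complement of a space of dimension at most three in
dimension seven. The upper bound suffices, so no immersion hypothesis is involved. -/
theorem exists_mem_bundleW_ne_zero (p : S) :
    ∃ w : TangentSpace (𝓡 7) (f p), w ∈ bundleW G o f p ∧ w ≠ 0 := by
  let K : Submodule ℝ (TangentSpace (𝓡 7) (f p)) := tangentPlane f p ⊔ (ℝ ∙ eta G o f p)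
  have h7 : finrank ℝ (TangentSpace (𝓡 7) (f p)) = 7 := by
    change finrank ℝ R7 = 7
    simp
  have hK : finrank ℝ K ≤ 3 := by
    refine (Submodule.finrank_add_le_finrank_add_finrank _ _).trans ?_
    have h1 : finrank ℝ (tangentPlane f p) ≤ 2 :=
      (LinearMap.finrank_range_le _).trans (finrank_tangentSpace p).le
    have h2 : finrank ℝ (ℝ ∙ eta G o f p) ≤ 1 := by
      simpa using finrank_span_le_card (R := ℝ) {eta G o f p}
    omega
  have hadd := K.finrank_add_finrank_orthogonal
  have hW : bundleW G o f p = Kᗮ := by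
    rw [bundleW, normalSpace, Submodule.inf_orthogonal]
  have hne : Kᗮ ≠ ⊥ := by
    intro h
    rw [h, finrank_bot] at hadd
    omega
  obtain ⟨w, hw, hw0⟩ := Submodule.exists_mem_ne_zero_of_ne_bot hne
  exact ⟨w, hW ▸ hw, hw0⟩

/-- The cross product of a tangent vector with a vector of `W` lies in `W`. -/
theorem cross_mfderiv_mem {p : S}
    (t : TangentSpace (𝓡 2) p) {w : TangentSpace (𝓡 7) (f p)} (hw : w ∈ bundleW G o f p) :
    G.cross (f p) (mfderiv (𝓡 2) (𝓡 7) f p t) w ∈ bundleW G o f p := by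
  obtain ⟨hT, hη⟩ := (mem_bundleW G o f).1 hw
  have hn : ⟪etaAux G o f p, w⟫_ℝ = 0 := by
    by_cases h0 : etaAux G o f p = 0
    · rw [h0, inner_zero_left]
    · rw [eta, inner_smul_left] at hη
      simpa [h0] using hη
  have hexp (t : TangentSpace (𝓡 2) p) : mfderiv (𝓡 2) (𝓡 7) f p t =
      (orientedBasis o p).repr t 0 • mfderiv (𝓡 2) (𝓡 7) f p (orientedBasis o p 0) +
        (orientedBasis o p).repr t 1 • mfderiv (𝓡 2) (𝓡 7) f p (orientedBasis o p 1) := by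
    conv_lhs => rw [← (orientedBasis o p).sum_repr t, Fin.sum_univ_two, map_add, map_smul,
      map_smul]
  rw [mem_bundleW]
  refine ⟨fun r ↦ ?_, ?_⟩
  -- By cyclicity the pairing is `⟪df r × df t, w⟫`, and the cross product of two tangent vectors is
  -- a multiple of `etaAux`.
  · rw [real_inner_comm, G.inner_cross, ← G.form_cycle, ← G.inner_cross, hexp r, hexp t,
      G.cross_combination, inner_smul_left]
    exact mul_eq_zero_of_right _ hn
  · have h (i : Fin 2) : G.form (f p) (mfderiv (𝓡 2) (𝓡 7) f p (orientedBasis o p i))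
        (etaAux G o f p) w = 0 := by
      fin_cases i
      · simp [etaAux, G.form_cross, hT]
      · rw [etaAux, G.cross_swap]
        simp [G.form_cross, hT]
    rw [real_inner_comm, G.inner_cross, G.form_swap, eta, hexp t]
    simp only [map_add, map_smul, LinearMap.add_apply, LinearMap.smul_apply, h, smul_zero,
      add_zero, neg_zero]

variable [IsContMDiffRiemannianBundle (𝓡 7) ∞ R7 (fun x : X ↦ TangentSpace (𝓡 7) x)]

/-- The connection on `W` is always compatible with the metric. -/
theorem connectionW_metric (hnabla : IsLeviCivita nabla) (hf : ContMDiff (𝓡 2) (𝓡 7) ∞ f) {p : S}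
    {s t : ∀ q : S, bundleW G o f q} (hs : DifferentiableSectionAt G o f s p)
    (ht : DifferentiableSectionAt G o f t p) (u : TangentSpace (𝓡 2) p) :
    mvfderiv (𝓡 2) (fun q ↦ ⟪s q, t q⟫_ℝ) p u =
      ⟪connectionW G o f nabla s p u, t p⟫_ℝ + ⟪s p, connectionW G o f nabla t p u⟫_ℝ := by
  refine (mvfderiv_inner ((hf p).mdifferentiableAt (by simp)) hnabla hs ht u).trans ?_
  rw [real_inner_comm (connectionW G o f nabla t p u), Submodule.coe_inner, Submodule.coe_inner,
    inner_connectionW s p u (t p).2, inner_connectionW t p u (s p).2]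
  congr 1
  exact real_inner_comm _ _

/-- The covariant derivative of the complex structure of `W` is the cross product with the
derivative of `η`. -/
theorem inner_connectionW_complexStructure (hnabla : IsLeviCivita nabla) (hG : G.IsParallel nabla)
    (hf : ContMDiff (𝓡 2) (𝓡 7) ∞ f)
    (himm : ∀ p : S, Function.Injective (mfderiv (𝓡 2) (𝓡 7) f p)) {p : S}
    {s : ∀ q : S, bundleW G o f q} (hs : DifferentiableSectionAt G o f s p)
    (u : TangentSpace (𝓡 2) p) {w : TangentSpace (𝓡 7) (f p)} (hw : w ∈ bundleW G o f p) :
    ⟪(connectionW G o f nabla (fun q ↦ complexStructure G o f q (s q)) p u :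
        TangentSpace (𝓡 7) (f p)), w⟫_ℝ =
      G.form (f p) (covAlong nabla f (eta G o f) p u) (s p) w +
        ⟪(complexStructure G o f p (connectionW G o f nabla s p u) :
          TangentSpace (𝓡 7) (f p)), w⟫_ℝ := by
  rw [inner_connectionW _ p u hw]
  refine (inner_covAlong_cross ((hf p).mdifferentiableAt (by simp)) hnabla hG
    (mdifferentiableAlongAt_eta hG hf himm p) hs u w).trans ?_
  congr 1
  -- Cross product with `η` is skew-adjoint. Moving it onto `w` produces another vector of `W`,
  -- against which the pull-back derivative of `s` may be exchanged for `∇^W s`.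
  have h (v : TangentSpace (𝓡 7) (f p)) : G.form (f p) (eta G o f p) v w =
      - ⟪v, G.cross (f p) (eta G o f p) w⟫_ℝ := by
    rw [G.form_swap, real_inner_comm, G.inner_cross]
  change _ = ⟪G.cross (f p) (eta G o f p)
    (connectionW G o f nabla s p u : TangentSpace (𝓡 7) (f p)), w⟫_ℝ
  rw [G.inner_cross, h, h, inner_connectionW s p u (cross_eta_mem G o f p w hw)]

theorem inner_covAlong_eta_self (hnabla : IsLeviCivita nabla) (hG : G.IsParallel nabla)
    (hf : ContMDiff (𝓡 2) (𝓡 7) ∞ f)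
    (himm : ∀ p : S, Function.Injective (mfderiv (𝓡 2) (𝓡 7) f p)) (p : S)
    (u : TangentSpace (𝓡 2) p) :
    ⟪covAlong nabla f (eta G o f) p u, eta G o f p⟫_ℝ = 0 := by
  have hη := mdifferentiableAlongAt_eta (o := o) hG hf himm p
  have h := mvfderiv_inner ((hf p).mdifferentiableAt (by simp)) hnabla hη hη u
  simp only [inner_eta_self himm, mvfderiv_const] at h
  rw [real_inner_comm (covAlong nabla f (eta G o f) p u) (eta G o f p)] at h
  simp only [zero_apply] at h
  linarith

/-- Only the `η`-component of `B` can obstruct membership in `W`. Differentiating `⟪df Y, η⟫ = 0`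
moves the derivative from `df Y` to `η`; the normal projection drops out because `η` is normal. -/
theorem secondFundamentalForm_mem_bundleW_iff (hnabla : IsLeviCivita nabla)
    (hG : G.IsParallel nabla) (hf : ContMDiff (𝓡 2) (𝓡 7) ∞ f)
    (himm : ∀ p : S, Function.Injective (mfderiv (𝓡 2) (𝓡 7) f p)) (p : S)
    (u : TangentSpace (𝓡 2) p) {Y : ∀ q : S, TangentSpace (𝓡 2) q}
    (hY : ContMDiffAt (𝓡 2) (𝓡 2).tangent ∞
      (fun q ↦ (⟨q, Y q⟩ : TangentBundle (𝓡 2) S)) p) :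
    secondFundamentalForm f nabla p u Y ∈ bundleW G o f p ↔
      ⟪(mfderiv (𝓡 2) (𝓡 7) f p (Y p) : TangentSpace (𝓡 7) (f p)),
        covAlong nabla f (eta G o f) p u⟫_ℝ = 0 := by
  have h := mvfderiv_inner ((hf p).mdifferentiableAt (by simp)) hnabla
    (mdifferentiableAlongAt_mfderiv hf hY) (mdifferentiableAlongAt_eta (o := o) hG hf himm p) u
  simp only [inner_mfderiv_eta, mvfderiv_const, zero_apply] at h
  have hN : eta G o f p ∈ normalSpace f p := by
    rw [normalSpace, Submodule.mem_orthogonal]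
    rintro _ ⟨t, rfl⟩
    exact inner_mfderiv_eta p t
  rw [bundleW, Submodule.mem_inf, Submodule.mem_orthogonal_singleton_iff_inner_left,
    secondFundamentalForm, and_iff_right (Submodule.starProjection_apply_mem _ _),
    Submodule.inner_starProjection_left_eq_right, Submodule.starProjection_eq_self_iff.2 hN]
  constructor <;> intro h' <;> linarith

/-- The right-hand side says that `∇_u η` has no tangential part. If so, `∇_u η` lies in `W`, where
`φ` vanishes. Conversely a nonzero tangential part would be detected by its cross product with a
nonzero vector of `W`. -/
theorem connectionWIsHermitian_iff (hnabla : IsLeviCivita nabla) (hG : G.IsParallel nabla)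
    (hf : ContMDiff (𝓡 2) (𝓡 7) ∞ f)
    (himm : ∀ p : S, Function.Injective (mfderiv (𝓡 2) (𝓡 7) f p)) :
    ConnectionWIsHermitian G o f nabla ↔ ∀ (p : S) (u t : TangentSpace (𝓡 2) p),
      ⟪(mfderiv (𝓡 2) (𝓡 7) f p t : TangentSpace (𝓡 7) (f p)),
        covAlong nabla f (eta G o f) p u⟫_ℝ = 0 := by
  constructor
  · intro h p u t
    set v := covAlong nabla f (eta G o f) p u with hv
    have hform {a b : TangentSpace (𝓡 7) (f p)} (ha : a ∈ bundleW G o f p)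
        (hb : b ∈ bundleW G o f p) : G.form (f p) v a b = 0 := by
      obtain ⟨s, hs, rfl⟩ := exists_section_bundleW hG hf himm ha
      have h1 := inner_connectionW_complexStructure hnabla hG hf himm hs u hb
      rw [h.parallel p s hs u] at h1
      linarith
    obtain ⟨t', ht'⟩ : ∃ t' : TangentSpace (𝓡 2) p, mfderiv (𝓡 2) (𝓡 7) f p t' =
        (tangentPlane f p).starProjection v :=
      (tangentPlane f p).starProjection_apply_mem v
    set τ : TangentSpace (𝓡 7) (f p) := mfderiv (𝓡 2) (𝓡 7) f p t' with hτ
    have hperp (r : TangentSpace (𝓡 2) p) :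
        ⟪(mfderiv (𝓡 2) (𝓡 7) f p r : TangentSpace (𝓡 7) (f p)), v - τ⟫_ℝ = 0 := by
      rw [ht']
      exact Submodule.mem_orthogonal _ _ |>.1
        (Submodule.sub_starProjection_mem_orthogonal v) _ ⟨r, rfl⟩
    have hW : v - τ ∈ bundleW G o f p := by
      rw [mem_bundleW]
      refine ⟨hperp, ?_⟩
      rw [inner_sub_right, real_inner_comm, inner_covAlong_eta_self hnabla hG hf himm p u,
        real_inner_comm, inner_mfderiv_eta, sub_zero]
    obtain ⟨w, hw, hw0⟩ := exists_mem_bundleW_ne_zero (G := G) (o := o) (f := f) p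
    have hc := cross_mfderiv_mem t' hw
    -- The pair `w`, `τ × w` of vectors in `W` is chosen so that `φ(τ, w, τ × w) = |τ × w|² =
    -- |τ|²|w|²`, while the part of `v` in `W` contributes nothing.
    have h0 : G.form (f p) τ w (G.cross (f p) τ w) = 0 := by
      have h1 := hform hw hc
      have h2 := form_eq_zero_of_mem_bundleW himm hW hw hc
      have h3 : v = (v - τ) + τ := by abel
      rw [h3, map_add, LinearMap.add_apply, LinearMap.add_apply, h2, zero_add] at h1
      exact h1
    have hτw : ⟪τ, w⟫_ℝ = 0 := ((mem_bundleW G o f).1 hw).1 t'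
    rw [← G.inner_cross, G.inner_cross_cross, hτw, mul_zero, sub_zero] at h0
    have hτ0 : τ = 0 := inner_self_eq_zero.1
      ((mul_eq_zero.1 h0).resolve_right (inner_self_ne_zero.2 hw0))
    have := hperp t
    rwa [hτ0, sub_zero] at this
  · intro h
    refine ⟨fun p s t hs ht u ↦ connectionW_metric hnabla hf hs ht u, fun p s hs u ↦ ?_⟩
    have hW : covAlong nabla f (eta G o f) p u ∈ bundleW G o f p := by
      rw [mem_bundleW]
      refine ⟨h p u, ?_⟩
      rw [real_inner_comm, inner_covAlong_eta_self hnabla hG hf himm p u]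
    refine ext_inner_right ℝ fun w ↦ ?_
    rw [Submodule.coe_inner, Submodule.coe_inner,
      inner_connectionW_complexStructure hnabla hG hf himm hs u w.2,
      form_eq_zero_of_mem_bundleW himm hW (s p).2 w.2, zero_add]

end Main

end G2Surface

open G2Surface
theorem mainTheorem2
    {X : Type*} [TopologicalSpace X] [T2Space X] [SecondCountableTopology X]
    [ChartedSpace R7 X] [IsManifold (𝓡 7) ∞ X]
    [RiemannianBundle (fun x : X ↦ TangentSpace (𝓡 7) x)]
    [IsContMDiffRiemannianBundle (𝓡 7) ∞ R7 (fun x : X ↦ TangentSpace (𝓡 7) x)]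
    (nabla : CovariantDerivative (𝓡 7) R7 (fun x : X ↦ TangentSpace (𝓡 7) x))
    (hnabla : IsLeviCivita nabla)
    (G : G2Structure X) (hG : G.IsParallel nabla)
    {S : Type*} [TopologicalSpace S] [T2Space S] [SecondCountableTopology S]
    [ChartedSpace R2 S] [IsManifold (𝓡 2) ∞ S] (o : SurfaceOrientation S)
    (f : S → X) (hf : ContMDiff (𝓡 2) (𝓡 7) ∞ f)
    (himm : ∀ p : S, Function.Injective (mfderiv (𝓡 2) (𝓡 7) f p)) :
    ConnectionWIsHermitian G o f nabla ↔ SecondFundamentalFormInW G o f nabla := by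
  rw [connectionWIsHermitian_iff hnabla hG hf himm]
  refine ⟨fun h p u Y hY ↦ (secondFundamentalForm_mem_bundleW_iff hnabla hG hf himm p u hY).2
    (h p u _), fun h p u t ↦ ?_⟩
  -- The second fundamental form is evaluated on vector fields, so `t` is extended to the smooth
  -- field with constant coordinates around `p`.
  rw [← surfaceField_continuousLinearMapAt p t]
  have hY := contMDiffAt_surfaceField p
    ((trivializationAt R2 (fun q : S ↦ TangentSpace (𝓡 2) q) p).continuousLinearMapAt ℝ p t)
  exact (secondFundamentalForm_mem_bundleW_iff hnabla hG hf himm p u hY).1 (h p u _ hY)
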